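/- Fix an integer $q\ge 3$ and write $[q]=\{1,\dots,q\}$. An instance of Vertex Deletion to $q$-Coloring is a pair $(G,L)$ of a finite simple graph $G$ and a list $L(v)\subseteq[q]$ for each vertex $v$. The task is to find a set $X\subseteq V(G)$ of minimum size such that $G-X$ has a proper coloring $\varphi\colon V(G)\setminus X\to[q]$ with $\varphi(v)\in L(v)$ for all $v\in V(G)\setminus X$; the problem without lists is the case $L(v)=[q]$ for all $v$. A set $Q\subseteq V(G)$ is a $(\sigma,\delta)$-hub of $G$ if every connected component of $G-Q$ has at most $\sigma$ vertices and is adjacent in $G$ to at most $\delta$ vertices of $Q$. Theorem 1.7. For every integer $q\ge 3$ and all integers $\sigma,\delta\ge 1$ there exist $\varepsilon>0$, a constant $c$ and a (deterministic) algorithm with the following property: given any instance $(G,L)$ of Vertex Deletion to $q$-Coloring, where $G$ has $n$ vertices, together with a $(\sigma,\delta)$-hub $Q$ of $G$ of size $p$, the algorithm outputs an optimal solution $X$ in time at most $(q+1-\varepsilon)^p\cdot c\,(n+1)^{c}$, that is, in time $(q+1-\varepsilon)^p\cdot n^{O(1)}$. Time is the number of elementary operations of a program on a pointer machine: a program is a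 finite system of recursive first-order procedures on binary cells, and each variable access, allocation of a cell, following of a pointer, test for nil, variable binding and procedure call costs one unit. The input consists of the adjacency matrix of $G$, the lists as a $0/1$ matrix, and the characteristic vector of $Q$; the output is the characteristic vector of $X$. -/

import Mathlib

/-! ### The machine model

Programs are finite systems of recursive first-order procedures that work on binary cells, as in
pure LISP.  The elementary operations are reading a variable, allocating a cell, following one of
the two pointers of a cell, and testing a pointer for `nil`; each costs one time unit, and so does
each variable binding and each procedure call.  There is no arithmetic and no comparison of whole
data structures.  Since every elementary operation touches a number of pointers that is bounded in
terms of the program alone, a computation of cost `t` is carried out by a pointer machine or a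
random access machine in `O(t)` elementary steps. -/

namespace HubColoring

/-- The data: `nil`, or a cell holding two pointers. -/
inductive Val : Type
  | nil : Val
  | cons : Val → Val → Val

namespace Val

/-- First component of a cell. -/
def hd : Val → Val
  | nil => nil
  | cons a _ => a

/-- Second component of a cell. -/
def tl : Val → Val
  | nil => nil
  | cons _ b => b

/-- `false` is `nil`, and `true` is a cell. -/
def ofBool : Bool → Val
  | false => nil
  | true => cons nil nil

/-- Linked lists, ended by `nil`. -/
def ofList : List Val → Val
  | [] => nil
  | a :: l => cons a (ofList l)

/-- A vector of `n` bits, as a linked list of length `n`. -/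
def ofBits {n : ℕ} (b : Fin n → Bool) : Val :=
  ofList (List.ofFn fun i => ofBool (b i))

/-- A matrix of bits, as the linked list of its rows. -/
def ofMatrix {m n : ℕ} (b : Fin m → Fin n → Bool) : Val :=
  ofList (List.ofFn fun i => ofBits (b i))

end Val

/-- Expressions.  Variables are numbered from the innermost binding outwards.
`ite c a b` is "if `c` is not `nil` then `a` else `b`", `bind a b` is "let `x` be `a` in `b`",
and `call f a` applies the procedure with number `f` to the value of `a`. -/
inductive Expr : Type
  | var : ℕ → Expr
  | nil : Expr
  | cons : Expr → Expr → Expr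
  | hd : Expr → Expr
  | tl : Expr → Expr
  | ite : Expr → Expr → Expr → Expr
  | bind : Expr → Expr → Expr
  | call : ℕ → Expr → Expr

/-- A program is the list of the bodies of its procedures.  Each procedure has one argument
(which may be a tuple built from cells); the procedure with number `0` is the main one. -/
abbrev Program : Type := List Expr

/-- `Eval P env e v t`: in the program `P`, when the variables have the values `env`, the evaluation
of the expression `e` ends with the value `v` after `t` elementary operations. -/
inductive Eval (P : Program) : List Val → Expr → Val → ℕ → Prop
  | var {env : List Val} {i : ℕ} {v : Val} (h : env[i]? = some v) : Eval P env (.var i) v 1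
  | nil {env : List Val} : Eval P env .nil .nil 1
  | cons {env : List Val} {a b : Expr} {u v : Val} {s t : ℕ}
      (ha : Eval P env a u s) (hb : Eval P env b v t) :
      Eval P env (.cons a b) (.cons u v) (s + t + 1)
  | hd {env : List Val} {a : Expr} {u : Val} {s : ℕ} (ha : Eval P env a u s) :
      Eval P env (.hd a) u.hd (s + 1)
  | tl {env : List Val} {a : Expr} {u : Val} {s : ℕ} (ha : Eval P env a u s) :
      Eval P env (.tl a) u.tl (s + 1)
  | ite_cons {env : List Val} {c a b : Expr} {x y v : Val} {s t : ℕ}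
      (hc : Eval P env c (.cons x y) s) (ha : Eval P env a v t) :
      Eval P env (.ite c a b) v (s + t + 1)
  | ite_nil {env : List Val} {c a b : Expr} {v : Val} {s t : ℕ}
      (hc : Eval P env c .nil s) (hb : Eval P env b v t) :
      Eval P env (.ite c a b) v (s + t + 1)
  | bind {env : List Val} {a b : Expr} {u v : Val} {s t : ℕ}
      (ha : Eval P env a u s) (hb : Eval P (u :: env) b v t) :
      Eval P env (.bind a b) v (s + t + 1)
  | call {env : List Val} {f : ℕ} {a b : Expr} {u v : Val} {s t : ℕ}
      (ha : Eval P env a u s) (hf : P[f]? = some b) (hb : Eval P [u] b v t) :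
      Eval P env (.call f a) v (s + t + 1)

/-- Computations are deterministic: result and cost are determined by program and input. -/
theorem Eval.unique {P : Program} {env : List Val} {e : Expr} {v : Val} {t : ℕ}
    (h : Eval P env e v t) : ∀ {v' : Val} {t' : ℕ}, Eval P env e v' t' → v = v' ∧ t = t' := by
  induction h with
  | var h => intro v' t' h'; cases h' with | var k => exact ⟨by simpa [h] using k, rfl⟩
  | nil => intro v' t' h'; cases h'; exact ⟨rfl, rfl⟩
  | cons _ _ iha ihb =>
    intro v' t' h'
    cases h' with
    | cons ka kb => obtain ⟨rfl, rfl⟩ := iha ka; obtain ⟨rfl, rfl⟩ := ihb kb; exact ⟨rfl, rfl⟩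
  | hd _ iha =>
    intro v' t' h'; cases h' with | hd ka => obtain ⟨rfl, rfl⟩ := iha ka; exact ⟨rfl, rfl⟩
  | tl _ iha =>
    intro v' t' h'; cases h' with | tl ka => obtain ⟨rfl, rfl⟩ := iha ka; exact ⟨rfl, rfl⟩
  | ite_cons _ _ ihc iha =>
    intro v' t' h'
    cases h' with
    | ite_cons kc ka => obtain ⟨_, rfl⟩ := ihc kc; obtain ⟨rfl, rfl⟩ := iha ka; exact ⟨rfl, rfl⟩
    | ite_nil kc _ => exact absurd (ihc kc).1 (by simp)
  | ite_nil _ _ ihc ihb =>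
    intro v' t' h'
    cases h' with
    | ite_cons kc _ => exact absurd (ihc kc).1 (by simp)
    | ite_nil kc kb => obtain ⟨_, rfl⟩ := ihc kc; obtain ⟨rfl, rfl⟩ := ihb kb; exact ⟨rfl, rfl⟩
  | bind _ _ iha ihb =>
    intro v' t' h'
    cases h' with
    | bind ka kb => obtain ⟨rfl, rfl⟩ := iha ka; obtain ⟨rfl, rfl⟩ := ihb kb; exact ⟨rfl, rfl⟩
  | call _ hf _ iha ihb =>
    intro v' t' h'
    cases h' with
    | call ka kf kb =>
      obtain ⟨rfl, rfl⟩ := iha ka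
      rw [hf] at kf
      obtain rfl := Option.some.inj kf
      obtain ⟨rfl, rfl⟩ := ihb kb
      exact ⟨rfl, rfl⟩

/-- On the input `x` the program `P` halts with the output `y` after `t` elementary operations. -/
def Program.Outputs (P : Program) (x y : Val) (t : ℕ) : Prop :=
  Eval P [x] (.call 0 (.var 0)) y t

/-! ### Hubs and the vertex deletion problem -/

/-- `Q` is a `(σ, δ)`-hub of `G`: every connected component of `G - Q` has at most `σ` vertices
and is adjacent in `G` to at most `δ` vertices of `Q`. -/
def IsHub {V : Type*} (G : SimpleGraph V) (σ δ : ℕ) (Q : Finset V) : Prop :=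
  ∀ C : (G.induce {v : V | v ∉ Q}).ConnectedComponent,
    C.supp.encard ≤ σ ∧ {u : V | u ∈ Q ∧ ∃ v ∈ C.supp, G.Adj u v}.encard ≤ δ

/-- `G - X` has a proper `q`-coloring in which every vertex `v` gets a color from `L v`. -/
def IsDeletionSet {V : Type*} {q : ℕ} (G : SimpleGraph V) (L : V → Finset (Fin q))
    (X : Finset V) : Prop :=
  ∃ φ : (G.induce {v : V | v ∉ X}).Coloring (Fin q), ∀ v : {v : V | v ∉ X}, φ v ∈ L v

/-- `X` is an optimal solution of the instance `(G, L)` of the vertex deletion problem: a smallest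
set of vertices whose deletion leaves a graph with a proper coloring that respects the lists. -/
def IsOptimalDeletionSet {V : Type*} {q : ℕ} (G : SimpleGraph V) (L : V → Finset (Fin q))
    (X : Finset V) : Prop :=
  IsDeletionSet G L X ∧ ∀ Y : Finset V, IsDeletionSet G L Y → X.card ≤ Y.card

/-- A vertex set, as its characteristic vector. -/
def encodeSet {n : ℕ} (X : Finset (Fin n)) : Val :=
  .ofBits fun v => decide (v ∈ X)

open Classical in
/-- The input: the adjacency matrix of `G`, the lists as a bit matrix with a row for each vertex
and a column for each color, and the hub. -/
noncomputable def encodeInput {n q : ℕ} (G : SimpleGraph (Fin n)) (L : Fin n → Finset (Fin q))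
    (Q : Finset (Fin n)) : Val :=
  .cons (.ofMatrix fun u v => decide (G.Adj u v))
    (.cons (.ofMatrix fun v i => decide (i ∈ L v)) (encodeSet Q))

/-- There is one program that, given any instance `(G, L)` of the vertex deletion problem with `q`
colors and any `(σ, δ)`-hub `Q` of `G`, outputs an optimal solution in time at most `T p n`, where
`p` is the number of vertices of `Q` and `n` is the number of vertices of `G`. -/
def SolvableInTime (q σ δ : ℕ) (T : ℕ → ℕ → ℝ) : Prop :=
  ∃ P : Program, ∀ (n : ℕ) (G : SimpleGraph (Fin n)) (L : Fin n → Finset (Fin q))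
    (Q : Finset (Fin n)), IsHub G σ δ Q →
      ∃ (X : Finset (Fin n)) (t : ℕ), IsOptimalDeletionSet G L X ∧
        P.Outputs (encodeInput G L Q) (encodeSet X) t ∧ (t : ℝ) ≤ T Q.card n

end HubColoring

/-! Deletion is treated as an additional color 0, which makes `d = q + 1` colors. Once the hub is
colored, the components outside of it can be completed independently and by brute force, so trying
all colorings of the hub takes about `d ^ p` rounds. Each component is a constraint on the at most
`δ` hub vertices next to it, and each pair of hub vertices is a further constraint. The cost of a
constraint is the least number of deletions and violations over all colorings of its component
(`minEnergy`); `objective` adds these costs to the number of hub vertices of color 0. Its minimum is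
the optimum: a deletion set gives a coloring without violations (`exists_objective_le`), and
deleting a vertex for each violation turns any hub coloring into a solution that is no larger than
its objective (`ones_solution_le`).

The saving comes from local domination. Given a partial assignment of the hub, an assignment `τ` of
`k ≤ K` free vertices may be left out if changing one color in `τ` never makes an extension worse
(`objective_update_le`); then only `d ^ k - 1` branches remain. With a suitable constant `K` such a
`τ` exists as long as there is a free vertex `v` (`prunable_ne_nil_of_free`). Call a constraint
relevant if giving `v` the color 0 can lower its cost. If two relevant constraints have witnesses
that agree on their common hub vertices, both witnesses are imposed together, and deleting `v` is
paid for by what it saves (`prunable_of_compatible`). Otherwise the witnesses are pairwise in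
conflict, so there are at most `d ^ D` relevant constraints (`card_le_pow_of_conflict`). Fixing all
their vertices makes the rest of the cost depend on the color of `v` in a known way, and of two
colors one is no better than the other (`prunable_of_few_relevant`).

Since `d ^ k - 1 ≤ (d - ε) ^ k` for `1 ≤ k ≤ K` (`exists_base`), a potential bounds the number of
rounds by `2 * (d - ε) ^ p` (`Prunes.potential_children`, `searchInv_step`). The existence argument
belongs to the analysis only: the algorithm tries all bounded candidates. That each round is a
polynomial computation of the machine follows from closure properties of `PolyTime`, and
`exists_loop` iterates it. -/

/-! ### Linking programs -/

namespace HubColoring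

open Polynomial

/-- Renumber the procedures that are called by an expression. -/
def Expr.shift (k : ℕ) : Expr → Expr
  | .var i => .var i
  | .nil => .nil
  | .cons a b => .cons (a.shift k) (b.shift k)
  | .hd a => .hd (a.shift k)
  | .tl a => .tl (a.shift k)
  | .ite c a b => .ite (c.shift k) (a.shift k) (b.shift k)
  | .bind a b => .bind (a.shift k) (b.shift k)
  | .call f a => .call (k + f) (a.shift k)

/-- The program `R` contains a copy of `P` that starts with the procedure number `k`. -/
def Contains (R P : Program) (k : ℕ) : Prop :=
  ∀ (i : ℕ) (b : Expr), P[i]? = some b → R[k + i]? = some (b.shift k)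

theorem Eval.shift {R P : Program} {k : ℕ} (hR : Contains R P k) {env : List Val} {e : Expr}
    {v : Val} {t : ℕ} (h : Eval P env e v t) : Eval R env (e.shift k) v t := by
  induction h with
  | var h => exact .var h
  | nil => exact .nil
  | cons _ _ iha ihb => exact .cons iha ihb
  | hd _ iha => exact .hd iha
  | tl _ iha => exact .tl iha
  | ite_cons _ _ ihc iha => exact .ite_cons ihc iha
  | ite_nil _ _ ihc ihb => exact .ite_nil ihc ihb
  | bind _ _ iha ihb => exact .bind iha ihb
  | call _ hf _ iha ihb => exact .call iha (hR _ _ hf) ihb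

/-- The main procedure of `P` turns `x` into `y` in `t` steps. -/
def Runs (P : Program) (x y : Val) (t : ℕ) : Prop :=
  ∃ b, P[0]? = some b ∧ Eval P [x] b y t

theorem Runs.call {R P : Program} {k : ℕ} (hR : Contains R P k) {x y : Val} {t : ℕ}
    (h : Runs P x y t) {env : List Val} {a : Expr} {s : ℕ} (ha : Eval R env a x s) :
    Eval R env (.call k a) y (s + t + 1) := by
  obtain ⟨b, hb, hbt⟩ := h
  exact .call ha (hR 0 b hb) (hbt.shift hR)

/-- The entry points are fixed before the main procedure `b`, because `b` has to mention them. This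
is possible since `b` takes up one place whatever its size. -/
theorem exists_link (P₁ P₂ P₃ : Program) : ∃ i₁ i₂ i₃ : ℕ, ∀ b : Expr, ∃ R : Program,
    R[0]? = some b ∧ Contains R P₁ i₁ ∧ Contains R P₂ i₂ ∧ Contains R P₃ i₃ := by
  refine ⟨1, 1 + P₁.length, 1 + P₁.length + P₂.length, fun b =>
    ⟨b :: (P₁.map (Expr.shift 1) ++ (P₂.map (Expr.shift (1 + P₁.length)) ++
      P₃.map (Expr.shift (1 + P₁.length + P₂.length)))), rfl, ?_, ?_, ?_⟩⟩
  · intro i c h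
    have hi := (List.getElem?_eq_some_iff.1 h).1
    rw [add_comm 1 i, List.getElem?_cons_succ, List.getElem?_append_left (by simpa using hi)]
    simp [h]
  · intro i c h
    have hi := (List.getElem?_eq_some_iff.1 h).1
    rw [show 1 + P₁.length + i = (P₁.length + i) + 1 by omega, List.getElem?_cons_succ,
      List.getElem?_append_right (by simp), List.getElem?_append_left (by simp; omega)]
    simp [h]
  · intro i c h
    have hi := (List.getElem?_eq_some_iff.1 h).1
    rw [show 1 + P₁.length + P₂.length + i = (P₁.length + (P₂.length + i)) + 1 by omega,
      List.getElem?_cons_succ, List.getElem?_append_right (by simp),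
      List.getElem?_append_right (by simp)]
    simp [h]

/-! ### Encodings and sizes -/

/-- The number of cells of a value, written as a tree. -/
def Val.size : Val → ℕ
  | .nil => 0
  | .cons a b => a.size + b.size + 1

/-- Types whose elements are represented by values. -/
class Enc (α : Type) where
  /-- The value that represents an element. -/
  enc : α → Val

instance : Enc Unit := ⟨fun _ => .nil⟩
instance : Enc Bool := ⟨Val.ofBool⟩
/-- Natural numbers are written in unary. -/
instance : Enc ℕ := ⟨fun n => .ofList (List.replicate n .nil)⟩
instance {α β : Type} [Enc α] [Enc β] : Enc (α × β) := ⟨fun x => .cons (Enc.enc x.1) (Enc.enc x.2)⟩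
instance {α : Type} [Enc α] : Enc (List α) := ⟨fun l => .ofList (l.map Enc.enc)⟩

/-- The size of the representation. -/
def sz {α : Type} [Enc α] (a : α) : ℕ := (Enc.enc a).size

section
variable {α β γ : Type} [Enc α] [Enc β] [Enc γ]

@[simp] theorem sz_unit (a : Unit) : sz a = 0 := rfl
@[simp] theorem sz_true : sz true = 1 := rfl
@[simp] theorem sz_false : sz false = 0 := rfl
theorem sz_bool (b : Bool) : sz b ≤ 1 := by cases b <;> simp
@[simp] theorem sz_pair (a : α) (b : β) : sz (a, b) = sz a + sz b + 1 := rfl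
@[simp] theorem sz_nil : sz ([] : List α) = 0 := rfl
@[simp] theorem sz_cons (a : α) (l : List α) : sz (a :: l) = sz a + sz l + 1 := rfl

@[simp] theorem sz_nat (n : ℕ) : sz n = n := by
  induction n with
  | zero => rfl
  | succ n ih =>
    change 0 + sz n + 1 = n + 1
    omega

@[simp] theorem sz_append (l m : List α) : sz (l ++ m) = sz l + sz m := by
  induction l with
  | nil => simp
  | cons a l ih => simp [ih]; omega

theorem length_le_sz (l : List α) : l.length ≤ sz l := by
  induction l with
  | nil => simp
  | cons a l ih => simp; omega

theorem sz_le_mul {l : List α} {k : ℕ} (h : ∀ a ∈ l, sz a ≤ k) : sz l ≤ l.length * (k + 1) := by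
  induction l with
  | nil => simp
  | cons b l ih =>
    have h1 := ih fun a ha => h a (List.mem_cons_of_mem _ ha)
    have h2 := h b List.mem_cons_self
    simp only [sz_cons, List.length_cons]
    nlinarith
end

theorem eval_mono (p : ℕ[X]) {m n : ℕ} (h : m ≤ n) : p.eval m ≤ p.eval n := by
  simp only [eval_eq_sum_range]
  gcongr

/-! ### Functions that are computed in polynomial time -/

/-- `f` is computed by a program in polynomial time, and its results have polynomial size. -/
def PolyTime {α β : Type} [Enc α] [Enc β] (f : α → β) : Prop :=
  ∃ (P : Program) (p : ℕ[X]), ∀ a : α, sz (f a) ≤ p.eval (sz a) ∧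
    ∃ t ≤ p.eval (sz a), Runs P (Enc.enc a) (Enc.enc (f a)) t

namespace PolyTime

section
variable {α β γ δ : Type} [Enc α] [Enc β] [Enc γ] [Enc δ]

theorem of_expr {f : α → β} (e : Expr) (k : ℕ) (hs : ∀ a, sz (f a) ≤ sz a + k)
    (he : ∀ a, ∃ t ≤ k, Eval [e] [Enc.enc a] e (Enc.enc (f a)) t) : PolyTime f := by
  refine ⟨[e], X + C k, fun a => ⟨by simpa using hs a, ?_⟩⟩
  obtain ⟨t, ht, h⟩ := he a
  exact ⟨t, by simp; omega, e, rfl, h⟩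

theorem of_enc_eq {f : α → β} (h : ∀ a, Enc.enc (f a) = Enc.enc a) : PolyTime f :=
  of_expr (.var 0) 1 (fun a => by simp [sz, h]) fun a => ⟨1, le_rfl, by rw [h]; exact .var rfl⟩

theorem id : PolyTime (fun a : α => a) := of_enc_eq fun _ => rfl

/-- The bound on the size of `f a` is what makes polynomial times compose: the second program runs
on an input of size at most `p.eval (sz a)`. -/
theorem comp {g : β → γ} {f : α → β} (hg : PolyTime g) (hf : PolyTime f) :
    PolyTime (fun a => g (f a)) := by
  obtain ⟨P, p, hP⟩ := hf
  obtain ⟨Q, q, hQ⟩ := hg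
  obtain ⟨i, j, _, h⟩ := exists_link P Q []
  obtain ⟨R, h0, hi, hj, -⟩ := h (.call j (.call i (.var 0)))
  refine ⟨R, p + q.comp p + 3, fun a => ?_⟩
  obtain ⟨h1, t, ht, h2⟩ := hP a
  obtain ⟨h3, s, hs, h4⟩ := hQ (f a)
  have := eval_mono q h1
  refine ⟨by simp; omega, _, ?_, _, h0, h4.call hj (h2.call hi (.var rfl))⟩
  simp
  omega

theorem pair {f : α → β} {g : α → γ} (hf : PolyTime f) (hg : PolyTime g) :
    PolyTime (fun a => (f a, g a)) := by
  obtain ⟨P, p, hP⟩ := hf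
  obtain ⟨Q, q, hQ⟩ := hg
  obtain ⟨i, j, _, h⟩ := exists_link P Q []
  obtain ⟨R, h0, hi, hj, -⟩ := h (.cons (.call i (.var 0)) (.call j (.var 0)))
  refine ⟨R, p + q + 5, fun a => ?_⟩
  obtain ⟨h1, t, ht, h2⟩ := hP a
  obtain ⟨h3, s, hs, h4⟩ := hQ a
  refine ⟨by simp; omega, _, ?_, _, h0, .cons (h2.call hi (.var rfl)) (h4.call hj (.var rfl))⟩
  simp
  omega

theorem ite {c : α → Bool} {f g : α → β} (hc : PolyTime c) (hf : PolyTime f) (hg : PolyTime g) :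
    PolyTime (fun a => if c a = true then f a else g a) := by
  obtain ⟨O, o, hO⟩ := hc
  obtain ⟨P, p, hP⟩ := hf
  obtain ⟨Q, q, hQ⟩ := hg
  obtain ⟨k, i, j, h⟩ := exists_link O P Q
  obtain ⟨R, h0, hk, hi, hj⟩ := h (.ite (.call k (.var 0)) (.call i (.var 0)) (.call j (.var 0)))
  refine ⟨R, o + p + q + 5, fun a => ?_⟩
  obtain ⟨-, r, hr, h'⟩ := hO a
  obtain ⟨h1, t, ht, h2⟩ := hP a
  obtain ⟨h3, s, hs, h4⟩ := hQ a
  cases hca : c a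
  · rw [hca] at h'
    simp only [hca, Bool.false_eq_true, if_false]
    refine ⟨by simp; omega, _, ?_, _, h0, .ite_nil (h'.call hk (.var rfl)) (h4.call hj (.var rfl))⟩
    simp
    omega
  · rw [hca] at h'
    simp only [hca, if_true]
    refine ⟨by simp; omega, _, ?_, _, h0, .ite_cons (h'.call hk (.var rfl)) (h2.call hi (.var rfl))⟩
    simp
    omega

theorem fst {f : α → β × γ} (hf : PolyTime f) : PolyTime (fun a => (f a).1) :=
  comp (g := Prod.fst) (of_expr (.hd (.var 0)) 2 (fun a => by cases a; simp; omega)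
    fun a => ⟨2, le_rfl, Eval.hd (u := Enc.enc a) (.var rfl)⟩) hf

theorem snd {f : α → β × γ} (hf : PolyTime f) : PolyTime (fun a => (f a).2) :=
  comp (g := Prod.snd) (of_expr (.tl (.var 0)) 2 (fun a => by cases a; simp; omega)
    fun a => ⟨2, le_rfl, Eval.tl (u := Enc.enc a) (.var rfl)⟩) hf

/-- Programs see encodings only, so functions whose values are encoded alike, even in different
types, share their program. -/
theorem relabel {f : α → β} {g : α → γ} (hf : PolyTime f) (h : ∀ a, Enc.enc (g a) = Enc.enc (f a)) :
    PolyTime g := by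
  obtain ⟨P, p, hP⟩ := hf
  exact ⟨P, p, fun a => by simpa only [sz, h] using hP a⟩

/-- An expression for a constant value. -/
def constExpr : Val → Expr
  | .nil => .nil
  | .cons a b => .cons (constExpr a) (constExpr b)

theorem eval_constExpr (P : Program) (env : List Val) (v : Val) :
    ∃ t, Eval P env (constExpr v) v t ∧ t ≤ 2 * v.size + 1 := by
  induction v with
  | nil => exact ⟨1, .nil, by simp [Val.size]⟩
  | cons a b iha ihb =>
    obtain ⟨s, hs, h1⟩ := iha
    obtain ⟨t, ht, h2⟩ := ihb
    exact ⟨_, .cons hs ht, by simp [Val.size]; omega⟩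

theorem const (b : β) : PolyTime (fun _ : α => b) :=
  of_expr (constExpr (Enc.enc b)) (2 * sz b + 1) (fun _ => by omega) fun a => by
    obtain ⟨t, h, ht⟩ := eval_constExpr [constExpr (Enc.enc b)] [Enc.enc a] (Enc.enc b)
    exact ⟨t, ht, h⟩

theorem cons {f : α → β} {g : α → List β} (hf : PolyTime f) (hg : PolyTime g) :
    PolyTime (fun a => f a :: g a) :=
  (pair hf hg).relabel fun _ => rfl

theorem headD {f : α → List β} (hf : PolyTime f) (d : β) : PolyTime (fun a => (f a).headD d) := by
  refine comp (g := fun l : List β => l.headD d) ?_ hf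
  refine of_expr (.ite (.var 0) (.hd (.var 0)) (constExpr (Enc.enc d))) (2 * sz d + 5)
    (fun l => by cases l <;> simp <;> omega) fun l => ?_
  cases l with
  | nil =>
    obtain ⟨t, h, ht⟩ := eval_constExpr [Expr.ite (.var 0) (.hd (.var 0)) (constExpr (Enc.enc d))]
      [Enc.enc ([] : List β)] (Enc.enc d)
    exact ⟨1 + t + 1, by simp only [sz]; omega, .ite_nil (.var rfl) h⟩
  | cons b l => exact ⟨1 + 2 + 1, by omega, .ite_cons (.var rfl)
      (Eval.hd (u := Enc.enc (b :: l)) (.var rfl))⟩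

theorem tail {f : α → List β} (hf : PolyTime f) : PolyTime (fun a => (f a).tail) :=
  comp (g := List.tail) (of_expr (.tl (.var 0)) 2 (fun l => by cases l <;> simp; omega)
    fun l => ⟨2, le_rfl, by cases l with
      | nil => exact Eval.tl (u := Enc.enc ([] : List β)) (.var rfl)
      | cons b l => exact Eval.tl (u := Enc.enc (b :: l)) (.var rfl)⟩) hf

theorem isEmpty {f : α → List β} (hf : PolyTime f) : PolyTime (fun a => (f a).isEmpty) := by
  refine comp (g := List.isEmpty) (of_expr (.ite (.var 0) .nil (.cons .nil .nil)) 5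
    (fun l => (sz_bool _).trans (by omega)) fun l => ?_) hf
  cases l with
  | nil => exact ⟨1 + 3 + 1, by omega, .ite_nil (.var rfl) (.cons .nil .nil)⟩
  | cons b l => exact ⟨1 + 1 + 1, by omega, .ite_cons (.var rfl) .nil⟩

/-- Recursion on lists, for functions with results of polynomial size. -/
theorem listRec {base : α → γ} {step : α × β × γ → γ} {F : α → List β → γ}
    (h0 : ∀ a, F a [] = base a) (h1 : ∀ a b l, F a (b :: l) = step (a, b, F a l))
    (hb : PolyTime base) (hs : PolyTime step)
    (hsz : ∃ p : ℕ[X], ∀ a l, sz (F a l) ≤ p.eval (sz a + sz l)) :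
    PolyTime (fun x : α × List β => F x.1 x.2) := by
  obtain ⟨P, p, hP⟩ := hb
  obtain ⟨Q, q, hQ⟩ := hs
  obtain ⟨r, hr⟩ := hsz
  obtain ⟨i, j, _, h⟩ := exists_link P Q []
  -- The argument is the pair of parameter and list, so its second pointer is `nil` exactly for the
  -- empty list; procedure 0 calls itself on the rest of the list.
  obtain ⟨R, hR, hi, hj, -⟩ := h (.ite (.tl (.var 0))
    (.call j (.cons (.hd (.var 0)) (.cons (.hd (.tl (.var 0)))
      (.call 0 (.cons (.hd (.var 0)) (.tl (.tl (.var 0)))))))) (.call i (.hd (.var 0))))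
  -- The bound `n` stays fixed through the recursion, so every round is charged the same amount.
  have key : ∀ (a : α) (l : List β) (n : ℕ), sz a + sz l ≤ n → ∃ t,
      t ≤ (l.length + 1) * (p.eval n + q.eval (n + r.eval n + 2) + 20) ∧
        Runs R (Enc.enc (a, l)) (Enc.enc (F a l)) t := by
    intro a l n hn
    induction l with
    | nil =>
      obtain ⟨-, t, ht, h2⟩ := hP a
      have := eval_mono p (show sz a ≤ n by simp at hn; omega)
      rw [h0]
      have h3 := Eval.hd (P := R) (env := [Enc.enc (a, ([] : List β))]) (a := .var 0)
        (u := Enc.enc (a, ([] : List β))) (.var rfl)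
      refine ⟨_, ?_, _, hR, .ite_nil (.tl (u := Enc.enc (a, ([] : List β))) (.var rfl))
        (h2.call hi h3)⟩
      simp
      omega
    | cons b l ih =>
      simp only [sz_cons] at hn
      obtain ⟨t, ht, b', hb', h2⟩ := ih (by omega)
      obtain ⟨-, s, hs, h4⟩ := hQ (a, b, F a l)
      have h5 : sz (a, b, F a l) ≤ n + r.eval n + 2 := by
        have h6 := (hr a l).trans (eval_mono r (show sz a + sz l ≤ n by omega))
        simp only [sz_pair]
        omega
      have h7 := eval_mono q h5
      obtain rfl := Option.some.inj (hb'.symm.trans hR)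
      rw [h1]
      have e0 : Eval R [Enc.enc (a, b :: l)] (.var 0) (Enc.enc (a, b :: l)) 1 := .var rfl
      refine ⟨_, ?_, _, hR, .ite_cons (.tl e0) (h4.call hj (.cons (.hd e0)
        (.cons (.hd (.tl e0)) (.call (.cons (.hd e0) (.tl (.tl e0))) hR h2))))⟩
      simp only [List.length_cons]
      rw [Nat.succ_mul]
      omega
  refine ⟨R, r + (X + 1) * (p + q.comp (X + r + 2) + 20), fun x => ?_⟩
  have hle : sz x.1 + sz x.2 ≤ sz x := by
    obtain ⟨a, l⟩ := x
    simp
  obtain ⟨t, ht, h2⟩ := key x.1 x.2 (sz x) hle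
  have h3 := (hr x.1 x.2).trans (eval_mono r hle)
  have h4 := length_le_sz x.2
  refine ⟨by simp; omega, t, ?_, h2⟩
  have h5 : x.2.length + 1 ≤ sz x + 1 := by omega
  have := Nat.mul_le_mul_right (p.eval (sz x) + q.eval (sz x + r.eval (sz x) + 2) + 20) h5
  simp
  omega

/-! ### Polynomial time operations on lists -/

theorem append {f g : α → List β} (hf : PolyTime f) (hg : PolyTime g) :
    PolyTime (fun a => f a ++ g a) := by
  have h : PolyTime (fun x : List β × List β => x.2 ++ x.1) :=
    listRec (F := fun m l => l ++ m) (base := fun m => m) (step := fun x => x.2.1 :: x.2.2)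
      (fun _ => rfl) (fun _ _ _ => rfl) id (cons (fst (snd id)) (snd (snd id)))
      ⟨X, fun m l => by simp; omega⟩
  exact h.comp (pair hg hf)

theorem flatMap {l : α → List β} {g : α → β → List γ} (hl : PolyTime l)
    (hg : PolyTime (fun x : α × β => g x.1 x.2)) : PolyTime (fun a => (l a).flatMap (g a)) := by
  have h : PolyTime (fun x : α × List β => x.2.flatMap (g x.1)) := by
    refine listRec (F := fun a l => l.flatMap (g a)) (base := fun _ => [])
      (step := fun x => g x.1 x.2.1 ++ x.2.2) (fun _ => rfl) (fun _ _ _ => rfl) (const _)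
      (append (comp hg (pair (fst id) (fst (snd id)))) (snd (snd id))) ?_
    obtain ⟨P, p, hP⟩ := hg
    refine ⟨X * p.comp (X + 1), fun a l => ?_⟩
    have key : ∀ n, sz a + sz l ≤ n → sz (l.flatMap (g a)) ≤ l.length * p.eval (n + 1) := by
      intro n hn
      induction l with
      | nil => simp
      | cons b l ih =>
        simp only [sz_cons] at hn
        have h1 := ih (by omega)
        have h2 := (hP (a, b)).1.trans (eval_mono p (show sz (a, b) ≤ n + 1 by simp; omega))
        simp only [List.flatMap_cons, sz_append, List.length_cons, Nat.succ_mul]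
        simp only at h2
        omega
    refine (key _ le_rfl).trans ?_
    have := length_le_sz l
    simp only [eval_mul, eval_X, eval_comp, eval_add, eval_one]
    gcongr
    omega
  exact h.comp (pair id hl)

theorem map {l : α → List β} {g : α → β → γ} (hl : PolyTime l)
    (hg : PolyTime (fun x : α × β => g x.1 x.2)) : PolyTime (fun a => (l a).map (g a)) := by
  simpa only [List.map_eq_flatMap] using flatMap hl (cons hg (const []))

theorem filter {l : α → List β} {g : α → β → Bool} (hl : PolyTime l)
    (hg : PolyTime (fun x : α × β => g x.1 x.2)) : PolyTime (fun a => (l a).filter (g a)) := by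
  have h := flatMap (g := fun a b => if g a b = true then [b] else []) hl
    (ite hg (cons (snd id) (const [])) (const []))
  refine h.relabel fun a => congrArg _ ?_
  induction l a with
  | nil => rfl
  | cons b l ih => by_cases h : g a b = true <;> simp [h, ih]

theorem not {f : α → Bool} (hf : PolyTime f) : PolyTime (fun a => !f a) := by
  refine (ite hf (const false) (const true)).relabel fun a => ?_
  cases f a <;> rfl

theorem and {f g : α → Bool} (hf : PolyTime f) (hg : PolyTime g) :
    PolyTime (fun a => f a && g a) := by
  refine (ite hf hg (const false)).relabel fun a => ?_
  cases f a <;> rfl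

theorem or {f g : α → Bool} (hf : PolyTime f) (hg : PolyTime g) :
    PolyTime (fun a => f a || g a) := by
  refine (ite hf (const true) hg).relabel fun a => ?_
  cases f a <;> rfl

theorem all {l : α → List β} {g : α → β → Bool} (hl : PolyTime l)
    (hg : PolyTime (fun x : α × β => g x.1 x.2)) : PolyTime (fun a => (l a).all (g a)) := by
  refine (isEmpty (filter (g := fun a b => !g a b) hl (not hg))).relabel fun a => ?_
  congr 1
  rw [Bool.eq_iff_iff]
  simp

theorem any {l : α → List β} {g : α → β → Bool} (hl : PolyTime l)
    (hg : PolyTime (fun x : α × β => g x.1 x.2)) : PolyTime (fun a => (l a).any (g a)) := by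
  refine (not (isEmpty (filter hl hg))).relabel fun a => ?_
  congr 1
  rw [Bool.eq_iff_iff]
  simp

/-! Numbers are lists of units. -/

theorem enc_nat (n : ℕ) : Enc.enc n = Enc.enc (List.replicate n ()) := by
  change Val.ofList _ = Val.ofList _
  simp [Enc.enc]

theorem units {f : α → ℕ} (hf : PolyTime f) : PolyTime (fun a => List.replicate (f a) ()) :=
  hf.relabel fun _ => (enc_nat _).symm

theorem length {l : α → List β} (hl : PolyTime l) : PolyTime (fun a => (l a).length) :=
  (map (g := fun _ _ => ()) hl (const _)).relabel fun a => by rw [enc_nat, List.map_const']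

theorem add {f g : α → ℕ} (hf : PolyTime f) (hg : PolyTime g) : PolyTime (fun a => f a + g a) := by
  simpa using length (append (units hf) (units hg))

theorem sum {l : α → List β} {g : α → β → ℕ} (hl : PolyTime l)
    (hg : PolyTime (fun x : α × β => g x.1 x.2)) : PolyTime (fun a => ((l a).map (g a)).sum) := by
  simpa [List.length_flatMap] using
    length (flatMap (g := fun a b => List.replicate (g a b) ()) hl (units hg))

/-- Recursion over the unary number, one tail for each unit; the intermediate results are suffixes
of the list and hence not larger than it. -/
theorem drop {n : α → ℕ} {l : α → List β} (hn : PolyTime n) (hl : PolyTime l) :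
    PolyTime (fun a => (l a).drop (n a)) := by
  have h : PolyTime (fun x : List β × List Unit => x.1.drop x.2.length) :=
    listRec (F := fun (l : List β) (m : List Unit) => l.drop m.length) (base := fun l => l)
      (step := fun x => x.2.2.tail)
      (fun _ => rfl) (fun _ _ _ => by simp) id (tail (snd (snd id)))
      ⟨X, fun l m => by
        have h : sz (l.take m.length ++ l.drop m.length) = sz l := by rw [List.take_append_drop]
        rw [sz_append] at h
        simp
        omega⟩
  simpa using h.comp (pair hl (units hn))

/-- In unary, the comparison amounts to dropping `g a` units from `f a` units and testing whether
anything is left. -/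
theorem le {f g : α → ℕ} (hf : PolyTime f) (hg : PolyTime g) :
    PolyTime (fun a => decide (f a ≤ g a)) := by
  refine (isEmpty (drop hg (units hf))).relabel fun a => ?_
  congr 1
  rw [Bool.eq_iff_iff]
  simp [Nat.sub_eq_zero_iff_le]

theorem beq {f g : α → ℕ} (hf : PolyTime f) (hg : PolyTime g) : PolyTime (fun a => f a == g a) := by
  refine (and (le hf hg) (le hg hf)).relabel fun a => ?_
  congr 1
  rw [Bool.eq_iff_iff]
  rw [beq_iff_eq, Bool.and_eq_true, decide_eq_true_iff, decide_eq_true_iff, le_antisymm_iff]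

theorem range {f : α → ℕ} (hf : PolyTime f) : PolyTime (fun a => List.range (f a)) := by
  have h : PolyTime (fun x : Unit × List Unit => List.range x.2.length) :=
    listRec (F := fun _ m => List.range m.length) (base := fun _ => [])
      (step := fun x => 0 :: x.2.2.map fun i => i + 1)
      (fun _ => rfl) (fun _ _ _ => by simp [List.range_succ_eq_map])
      (const _) (cons (const 0) (map (snd (snd id)) (add (snd id) (const 1))))
      ⟨X * (X + 1), fun _ m => by
        have h : sz (List.range m.length) ≤ m.length * (m.length + 1) := by
          simpa using sz_le_mul (l := List.range m.length) (k := m.length)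
            fun a ha => by simpa using (List.mem_range.1 ha).le
        have := length_le_sz m
        simp only [eval_mul, eval_X, eval_add, eval_one, sz_unit, zero_add]
        exact h.trans (by gcongr)⟩
  simpa using h.comp (pair (const ()) (units hf))

end

end PolyTime

/-- A loop that runs `step` as long as `cond` holds, with a potential that decreases by at least
one in every round. -/
theorem exists_loop {α : Type} [Enc α] {cond : α → Bool} {step : α → α} (hc : PolyTime cond)
    (hs : PolyTime step) : ∃ (R : Program) (p : ℕ[X]), ∀ (Inv : α → Prop) (Φ : α → ℝ) (M : ℕ),
      (∀ s, Inv s → sz s ≤ M ∧ 0 ≤ Φ s ∧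
        (cond s = true → Inv (step s) ∧ Φ (step s) + 1 ≤ Φ s)) →
      ∀ s, Inv s → ∃ s', Inv s' ∧ cond s' = false ∧ ∃ t : ℕ, (t : ℝ) ≤ (Φ s + 1) * p.eval M ∧
        Runs R (Enc.enc s) (Enc.enc s') t := by
  obtain ⟨P, p, hP⟩ := hc
  obtain ⟨Q, q, hQ⟩ := hs
  obtain ⟨i, j, _, h⟩ := exists_link P Q []
  obtain ⟨R, hR, hi, hj, -⟩ := h (.ite (.call i (.var 0)) (.call 0 (.call j (.var 0))) (.var 0))
  -- Program and polynomial are chosen before invariant, potential and size bound, which may thus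
  -- vary with the instance. The floor of the potential drops strictly in each round and carries the
  -- induction.
  refine ⟨R, p + q + 20, fun Inv Φ M hInv s => ?_⟩
  induction hn : ⌊Φ s⌋₊ using Nat.strong_induction_on generalizing s with
  | _ n ih =>
    intro hs
    obtain ⟨hM, hΦ, hstep⟩ := hInv s hs
    obtain ⟨-, t₁, ht₁, h1⟩ := hP s
    obtain ⟨-, t₂, ht₂, h2⟩ := hQ s
    replace ht₁ := ht₁.trans (eval_mono p hM)
    replace ht₂ := ht₂.trans (eval_mono q hM)
    cases hcs : cond s with
    | false =>
      rw [hcs] at h1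
      refine ⟨s, hs, hcs, _, ?_, _, hR, .ite_nil (h1.call hi (.var rfl)) (.var rfl)⟩
      have h3 : ((1 + t₁ + 1 + 1 + 1 : ℕ) : ℝ) ≤ ((p + q + 20).eval M : ℕ) := by
        norm_cast
        simp
        omega
      nlinarith
    | true =>
      obtain ⟨hI, hd⟩ := hstep hcs
      have h0 := (hInv _ hI).2.1
      have hlt : ⌊Φ (step s)⌋₊ < n := by
        rw [← hn, ← Nat.add_one_le_iff, ← Nat.floor_add_one h0]
        exact Nat.floor_le_floor hd
      obtain ⟨s', hs', hcs', t, ht, b, hb, h3⟩ := ih _ hlt (step s) rfl hI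
      obtain rfl := Option.some.inj (hb.symm.trans hR)
      rw [hcs] at h1
      refine ⟨s', hs', hcs', _, ?_, _, hR, .ite_cons (h1.call hi (.var rfl))
        (.call (h2.call hj (.var rfl)) hR h3)⟩
      have h4 : ((1 + t₁ + 1 + (1 + t₂ + 1 + t + 1) + 1 : ℕ) : ℝ) ≤
          ((p + q + 20).eval M : ℕ) + t := by
        norm_cast
        simp
        omega
      have h5 : (0 : ℝ) ≤ ((p + q + 20).eval M : ℕ) := by positivity
      nlinarith

/-! ### The algorithm

There are `d = q + 1` colors; the color `0` stands for deletion, and the color `a + 1` for the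
element `a` of `Fin q`. -/

/-- Adjacency matrix, lists, and hub. -/
abbrev Inst : Type := List (List Bool) × List (List Bool) × List Bool

/-- Partial assignments of colors to vertices, as association lists. -/
abbrev PA : Type := List (ℕ × ℕ)

/-- A constraint: a list of hub vertices, and a list of vertices outside of the hub. -/
abbrev Con : Type := List ℕ × List ℕ

/-- The bit number `i`. -/
def bit (l : List Bool) (i : ℕ) : Bool := (l.drop i).headD false

/-- Adjacency. -/
def adj (I : Inst) (u v : ℕ) : Bool := bit ((I.1.drop u).headD []) v

/-- The color `a` is zero or on the list of `v`. -/
def allowed (I : Inst) (v a : ℕ) : Bool := bit (true :: (I.2.1.drop v).headD []) a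

/-- All vertices. -/
def verts (I : Inst) : List ℕ := List.range I.1.length

/-- The vertices of the hub. -/
def hubs (I : Inst) : List ℕ := (verts I).filter fun v => bit I.2.2 v

/-- The vertices outside of the hub. -/
def outer (I : Inst) : List ℕ := (verts I).filter fun v => !bit I.2.2 v

/-- The vertices outside of the hub at distance at most `k` from `w` there. -/
def near (I : Inst) : ℕ → ℕ → List ℕ
  | 0, w => (outer I).filter fun u => u == w
  | k + 1, w => (outer I).filter fun u => (near I k w).any fun x => x == u || adj I x u

/-- The components of the graph without the hub, if they have at most `s` vertices. -/
def comps (s : ℕ) (I : Inst) : List (List ℕ) :=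
  ((outer I).filter fun w => (near I s w).headD 0 == w).map fun w => near I s w

/-- The hub vertices that are adjacent to `C`. -/
def scope (I : Inst) (C : List ℕ) : List ℕ := (hubs I).filter fun u => C.any fun x => adj I x u

/-- The constraints: the components, and the pairs of hub vertices. -/
def constraints (s : ℕ) (I : Inst) : List Con :=
  ((comps s I).map fun C => (scope I C, C)) ++
    (hubs I).flatMap fun u => (hubs I).map fun v => ([u, v], [])

/-- The color of `v`, where unassigned vertices have the color zero. -/
def col (f : PA) (v : ℕ) : ℕ := ((f.filter fun p => p.1 == v).map fun p => p.2).headD 0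

/-- The vertex `v` is assigned. -/
def assigned (f : PA) (v : ℕ) : Bool := f.any fun p => p.1 == v

/-- All assignments of colors to the members of a list of length at most `k`. -/
def assigns (d : ℕ) : ℕ → List ℕ → List PA
  | 0, _ => [[]]
  | k + 1, l => if l.isEmpty = true then [[]] else
      (assigns d k l.tail).flatMap fun h => (List.range d).map fun a => (l.headD 0, a) :: h

/-- The number of deletions in the second part of a constraint, and of violations of lists and
edges within the constraint. -/
def energy (I : Inst) (c : Con) (g : ℕ → ℕ) : ℕ :=
  (c.2.map fun v => if (g v == 0) = true then 1 else 0).sum +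
    ((c.1 ++ c.2).map fun v => (if allowed I v (g v) = true then 0 else 1) +
      ((c.1 ++ c.2).map fun u =>
        if (adj I u v && (g u == g v && !(g v == 0))) = true then 1 else 0).sum).sum

/-- The best extension of `f` to the second part of the constraint. -/
def best (d s : ℕ) (I : Inst) (c : Con) (f : PA) : PA :=
  ((assigns d s c.2).filter fun h => (assigns d s c.2).all fun h' =>
    decide (energy I c (col (h ++ f)) ≤ energy I c (col (h' ++ f)))).headD []

/-- The least energy of an extension of `f`. -/
def cost (d s : ℕ) (I : Inst) (c : Con) (f : PA) : ℕ := energy I c (col (best d s I c f ++ f))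

/-- The first part of the constraint is assigned. -/
def determined (c : Con) (f : PA) : Bool := c.1.all fun u => assigned f u

/-- The total cost of the determined constraints and of the vertex `v`. -/
def localCost (d s : ℕ) (I : Inst) (f₀ f : PA) (v : ℕ) : ℕ :=
  ((constraints s I).map fun c => if determined c f₀ = true then cost d s I c f else 0).sum +
    if (col f v == 0) = true then 1 else 0

/-- A sufficient condition for the extensions of `f` to be no better than what is obtained from them
by giving the color `x` to `v`. -/
def dominated (d s D : ℕ) (I : Inst) (f : PA) (v x : ℕ) : Bool :=
  decide (localCost d s I f ((v, x) :: f) v ≤ localCost d s I f f v) &&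
    (constraints s I).all fun c => determined c f || (assigns d D c.1).all fun g =>
      decide (cost d s I c ((v, x) :: f ++ g) ≤ cost d s I c (f ++ g))

/-- The hub vertices that are not assigned. -/
def free (I : Inst) (f : PA) : List ℕ := (hubs I).filter fun u => !assigned f u

/-- The lists of at most `k` different members of `U`. -/
def tuples : ℕ → List ℕ → List (List ℕ)
  | 0, _ => [[]]
  | k + 1, U => tuples k U ++ (tuples k U).flatMap fun t =>
      (U.filter fun u => !t.any fun x => x == u).map fun u => u :: t

/-- The assignments of at most `K` free vertices, with a change of one color. -/
def changes (d K : ℕ) (I : Inst) (f : PA) : List (PA × ℕ × ℕ) :=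
  (tuples K (free I f)).flatMap fun S => (assigns d K S).flatMap fun τ => S.flatMap fun v =>
    (List.range d).map fun x => (τ, v, x)

/-- The changes that show that an assignment can be left out. -/
def prunable (d s D K : ℕ) (I : Inst) (f : PA) : List (PA × ℕ × ℕ) :=
  (changes d K I f).filter fun y =>
    !(col y.1 y.2.1 == y.2.2) && dominated d s D I (y.1 ++ f) y.2.1 y.2.2

/-- The extensions of `f` by the assignments of the domain of `τ` other than `τ`. -/
def children (d K : ℕ) (f τ : PA) : List PA :=
  ((assigns d K (τ.map fun p => p.1)).filter fun τ' => τ.any fun p => !(col τ' p.1 == p.2)).map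
    fun τ' => τ' ++ f

/-- The assignment `f` of the hub, and best assignments of the components. -/
def completion (d s : ℕ) (I : Inst) (f : PA) : PA :=
  ((constraints s I).flatMap fun c => best d s I c f) ++ f

/-- The vertex `v` is to be deleted. -/
def toDelete (I : Inst) (h : PA) (v : ℕ) : Bool :=
  col h v == 0 || (!allowed I v (col h v) ||
    (List.range v).any fun u => adj I u v && col h u == col h v)

/-- The solution that belongs to an assignment of the hub. -/
def solution (d s : ℕ) (I : Inst) (f : PA) : List Bool :=
  (verts I).map fun v => toDelete I (completion d s I f) v

/-- The number of ones. -/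
def ones (l : List Bool) : ℕ := (l.map fun b => if b = true then 1 else 0).sum

/-- The state of the search: the instance, the assignments that are still to be extended, and the
best solution so far. -/
abbrev Search : Type := Inst × List PA × List Bool

/-- The search is not finished. -/
def active (z : Search) : Bool := !z.2.1.isEmpty

/-- One step of the search. -/
def searchStep (d s D K : ℕ) (z : Search) : Search :=
  if (prunable d s D K z.1 (z.2.1.headD [])).isEmpty = true then
    (z.1, z.2.1.tail, if decide (ones (solution d s z.1 (z.2.1.headD [])) ≤ ones z.2.2) = true then
      solution d s z.1 (z.2.1.headD []) else z.2.2)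
  else
    (z.1, children d K (z.2.1.headD []) ((prunable d s D K z.1 (z.2.1.headD [])).headD
      ([], 0, 0)).1 ++ z.2.1.tail, z.2.2)

/-- The begin of the search. -/
def searchInit (I : Inst) : Search := (I, [[]], (verts I).map fun _ => true)

/-! ### The running time of the parts of the algorithm -/

namespace PolyTime

section
variable {α : Type} [Enc α]

theorem bit {l : α → List Bool} {i : α → ℕ} (hl : PolyTime l) (hi : PolyTime i) :
    PolyTime (fun a => bit (l a) (i a)) :=
  headD (drop hi hl) false

theorem adj {I : α → Inst} {u v : α → ℕ} (hI : PolyTime I) (hu : PolyTime u) (hv : PolyTime v) :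
    PolyTime (fun a => adj (I a) (u a) (v a)) :=
  bit (headD (drop hu (fst hI)) []) hv

theorem allowed {I : α → Inst} {u v : α → ℕ} (hI : PolyTime I) (hu : PolyTime u)
    (hv : PolyTime v) : PolyTime (fun a => allowed (I a) (u a) (v a)) :=
  bit (cons (const true) (headD (drop hu (fst (snd hI))) [])) hv

theorem verts {I : α → Inst} (hI : PolyTime I) : PolyTime (fun a => verts (I a)) :=
  range (length (fst hI))

theorem hubs {I : α → Inst} (hI : PolyTime I) : PolyTime (fun a => hubs (I a)) := by
  refine comp (g := HubColoring.hubs) ?_ hI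
  unfold HubColoring.hubs
  repeat' (with_reducible first
    | apply id | apply fst | apply snd | apply filter | apply verts | apply bit)

theorem outer {I : α → Inst} (hI : PolyTime I) : PolyTime (fun a => outer (I a)) := by
  refine comp (g := HubColoring.outer) ?_ hI
  unfold HubColoring.outer
  repeat' (with_reducible first
    | apply id | apply fst | apply snd | apply filter | apply verts | apply not | apply bit)

/-- Since `k` is a constant of the algorithm, it suffices to build a separate program for each `k`.
-/
theorem near (k : ℕ) {I : α → Inst} {w : α → ℕ} (hI : PolyTime I) (hw : PolyTime w) :
    PolyTime (fun a => near (I a) k (w a)) := by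
  refine (comp (g := fun x : Inst × ℕ => HubColoring.near x.1 k x.2) ?_ (pair hI hw) :)
  induction k with
  | zero =>
    simp only [HubColoring.near]
    repeat' (with_reducible first
      | apply id | apply fst | apply snd | apply filter | apply outer | apply beq)
  | succ k ih =>
    have h {β : Type} [Enc β] {I : β → Inst} {w : β → ℕ} (hI : PolyTime I) (hw : PolyTime w) :
      PolyTime (fun a => HubColoring.near (I a) k (w a)) := ih.comp (pair hI hw)
    simp only [HubColoring.near]
    repeat' (with_reducible first
      | apply id | apply fst | apply snd | apply filter | apply outer | apply any | apply h
      | apply or | apply adj | apply beq)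

theorem comps (s : ℕ) {I : α → Inst} (hI : PolyTime I) : PolyTime (fun a => comps s (I a)) := by
  refine comp (g := HubColoring.comps s) ?_ hI
  unfold HubColoring.comps
  repeat' (with_reducible first
    | apply id | apply fst | apply snd | apply map | apply filter | apply outer | apply beq
    | apply near | apply headD)

theorem scope {I : α → Inst} {C : α → List ℕ} (hI : PolyTime I) (hC : PolyTime C) :
    PolyTime (fun a => scope (I a) (C a)) := by
  refine (comp (g := fun x : Inst × List ℕ => HubColoring.scope x.1 x.2) ?_ (pair hI hC) :)
  unfold HubColoring.scope
  repeat' (with_reducible first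
    | apply id | apply fst | apply snd | apply filter | apply hubs | apply any | apply adj)

theorem constraints (s : ℕ) {I : α → Inst} (hI : PolyTime I) :
    PolyTime (fun a => constraints s (I a)) := by
  refine comp (g := HubColoring.constraints s) ?_ hI
  unfold HubColoring.constraints
  repeat' (with_reducible first
    | apply id | apply fst | apply snd | apply append | apply map | apply comps | apply flatMap
    | apply hubs | apply scope | apply cons | apply const | apply pair)

theorem col {f : α → PA} {v : α → ℕ} (hf : PolyTime f) (hv : PolyTime v) :
    PolyTime (fun a => col (f a) (v a)) := by
  refine (comp (g := fun x : PA × ℕ => HubColoring.col x.1 x.2) ?_ (pair hf hv) :)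
  unfold HubColoring.col
  repeat' (with_reducible first
    | apply id | apply fst | apply snd | apply headD | apply map | apply filter | apply beq)

theorem assigned {f : α → PA} {v : α → ℕ} (hf : PolyTime f) (hv : PolyTime v) :
    PolyTime (fun a => assigned (f a) (v a)) := by
  refine (comp (g := fun x : PA × ℕ => HubColoring.assigned x.1 x.2) ?_ (pair hf hv) :)
  unfold HubColoring.assigned
  repeat' (with_reducible first
    | apply id | apply fst | apply snd | apply any | apply beq)

/-- Induction on the constant `k`: the enumeration is exponential in `k` but polynomial in the
input. -/
theorem assigns (d k : ℕ) {l : α → List ℕ} (hl : PolyTime l) :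
    PolyTime (fun a => assigns d k (l a)) := by
  refine comp (g := HubColoring.assigns d k) ?_ hl
  induction k with
  | zero =>
    exact const [[]]
  | succ k ih =>
    have h {β : Type} [Enc β] {l : β → List ℕ} (hl : PolyTime l) :
      PolyTime (fun a => HubColoring.assigns d k (l a)) := ih.comp hl
    change PolyTime fun l => HubColoring.assigns d (k + 1) l
    simp only [HubColoring.assigns]
    refine ite (isEmpty id) (const _) ?_
    repeat' (with_reducible first
      | apply id | apply fst | apply snd | apply flatMap | apply h | apply tail | apply map
      | apply range | apply const | apply cons | apply headD | apply pair)

/-- A coloring is a function and not a datum; only colorings of the form `col f` are needed, and `f`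
represents them. -/
theorem energy {I : α → Inst} {c : α → Con} {f : α → PA} (hI : PolyTime I) (hc : PolyTime c)
    (hf : PolyTime f) : PolyTime (fun a => energy (I a) (c a) (HubColoring.col (f a))) := by
  refine (comp
    (g := fun x : Inst × Con × PA => HubColoring.energy x.1 x.2.1 (HubColoring.col x.2.2))
    ?_ (pair hI (pair hc hf)) :)
  unfold HubColoring.energy
  repeat' (with_reducible first
    | apply id | apply fst | apply snd | apply add | apply sum | apply append | apply ite
    | apply beq | apply const | apply allowed | apply adj | apply and | apply not | apply col)

theorem best (d s : ℕ) {I : α → Inst} {c : α → Con} {f : α → PA} (hI : PolyTime I)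
    (hc : PolyTime c) (hf : PolyTime f) : PolyTime (fun a => best d s (I a) (c a) (f a)) := by
  refine (comp (g := fun x : Inst × Con × PA => HubColoring.best d s x.1 x.2.1 x.2.2)
    ?_ (pair hI (pair hc hf)) :)
  unfold HubColoring.best
  repeat' (with_reducible first
    | apply id | apply fst | apply snd | apply headD | apply filter | apply assigns | apply all
    | apply le | apply energy | apply append)

theorem cost (d s : ℕ) {I : α → Inst} {c : α → Con} {f : α → PA} (hI : PolyTime I)
    (hc : PolyTime c) (hf : PolyTime f) : PolyTime (fun a => cost d s (I a) (c a) (f a)) :=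
  energy hI hc (append (best d s hI hc hf) hf)

theorem determined {c : α → Con} {f : α → PA} (hc : PolyTime c) (hf : PolyTime f) :
    PolyTime (fun a => determined (c a) (f a)) := by
  refine (comp (g := fun x : Con × PA => HubColoring.determined x.1 x.2) ?_ (pair hc hf) :)
  unfold HubColoring.determined
  repeat' (with_reducible first
    | apply id | apply fst | apply snd | apply all | apply assigned)

theorem localCost (d s : ℕ) {I : α → Inst} {f₀ f : α → PA} {v : α → ℕ} (hI : PolyTime I)
    (hf₀ : PolyTime f₀) (hf : PolyTime f) (hv : PolyTime v) :
    PolyTime (fun a => localCost d s (I a) (f₀ a) (f a) (v a)) := by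
  refine (comp (g := fun x : Inst × PA × PA × ℕ =>
    HubColoring.localCost d s x.1 x.2.1 x.2.2.1 x.2.2.2) ?_ (pair hI (pair hf₀ (pair hf hv))) :)
  unfold HubColoring.localCost
  repeat' (with_reducible first
    | apply id | apply fst | apply snd | apply add | apply sum | apply constraints | apply ite
    | apply determined | apply cost | apply const | apply beq | apply col)

theorem dominated (d s D : ℕ) {I : α → Inst} {f : α → PA} {v x : α → ℕ} (hI : PolyTime I)
    (hf : PolyTime f) (hv : PolyTime v) (hx : PolyTime x) :
    PolyTime (fun a => dominated d s D (I a) (f a) (v a) (x a)) := by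
  refine (comp (g := fun x : Inst × PA × ℕ × ℕ =>
    HubColoring.dominated d s D x.1 x.2.1 x.2.2.1 x.2.2.2) ?_ (pair hI (pair hf (pair hv hx))) :)
  unfold HubColoring.dominated
  repeat' (with_reducible first
    | apply id | apply fst | apply snd | apply and | apply le | apply localCost | apply all
    | apply constraints | apply or | apply determined | apply assigns | apply cost | apply cons
    | apply append)

theorem free {I : α → Inst} {f : α → PA} (hI : PolyTime I) (hf : PolyTime f) :
    PolyTime (fun a => free (I a) (f a)) := by
  refine (comp (g := fun x : Inst × PA => HubColoring.free x.1 x.2) ?_ (pair hI hf) :)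
  unfold HubColoring.free
  repeat' (with_reducible first
    | apply id | apply fst | apply snd | apply filter | apply hubs | apply not | apply assigned)

theorem tuples (k : ℕ) {U : α → List ℕ} (hU : PolyTime U) :
    PolyTime (fun a => tuples k (U a)) := by
  refine comp (g := HubColoring.tuples k) ?_ hU
  induction k with
  | zero =>
    exact const [[]]
  | succ k ih =>
    have h {β : Type} [Enc β] {l : β → List ℕ} (hl : PolyTime l) :
      PolyTime (fun a => HubColoring.tuples k (l a)) := ih.comp hl
    change PolyTime fun l => HubColoring.tuples (k + 1) l
    simp only [HubColoring.tuples]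
    repeat' (with_reducible first
      | apply id | apply fst | apply snd | apply append | apply h | apply flatMap | apply map
      | apply filter | apply not | apply any | apply beq | apply cons)

theorem changes (d K : ℕ) {I : α → Inst} {f : α → PA} (hI : PolyTime I) (hf : PolyTime f) :
    PolyTime (fun a => changes d K (I a) (f a)) := by
  refine (comp (g := fun x : Inst × PA => HubColoring.changes d K x.1 x.2) ?_ (pair hI hf) :)
  unfold HubColoring.changes
  repeat' (with_reducible first
    | apply id | apply fst | apply snd | apply flatMap | apply tuples | apply free | apply assigns
    | apply map | apply range | apply const | apply pair)

theorem prunable (d s D K : ℕ) {I : α → Inst} {f : α → PA} (hI : PolyTime I) (hf : PolyTime f) :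
    PolyTime (fun a => prunable d s D K (I a) (f a)) := by
  refine (comp (g := fun x : Inst × PA => HubColoring.prunable d s D K x.1 x.2) ?_ (pair hI hf) :)
  unfold HubColoring.prunable
  repeat' (with_reducible first
    | apply id | apply fst | apply snd | apply filter | apply changes | apply and | apply not
    | apply beq | apply col | apply dominated | apply append)

theorem children (d K : ℕ) {f τ : α → PA} (hf : PolyTime f) (hτ : PolyTime τ) :
    PolyTime (fun a => children d K (f a) (τ a)) := by
  refine (comp (g := fun x : PA × PA => HubColoring.children d K x.1 x.2) ?_ (pair hf hτ) :)
  unfold HubColoring.children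
  repeat' (with_reducible first
    | apply id | apply fst | apply snd | apply map | apply filter | apply assigns | apply any
    | apply not | apply beq | apply col | apply append)

theorem completion (d s : ℕ) {I : α → Inst} {f : α → PA} (hI : PolyTime I) (hf : PolyTime f) :
    PolyTime (fun a => completion d s (I a) (f a)) := by
  refine (comp (g := fun x : Inst × PA => HubColoring.completion d s x.1 x.2) ?_ (pair hI hf) :)
  unfold HubColoring.completion
  repeat' (with_reducible first
    | apply id | apply fst | apply snd | apply append | apply flatMap | apply constraints
    | apply best)

theorem toDelete {I : α → Inst} {h : α → PA} {v : α → ℕ} (hI : PolyTime I) (hh : PolyTime h)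
    (hv : PolyTime v) : PolyTime (fun a => toDelete (I a) (h a) (v a)) := by
  refine comp (g := fun x : Inst × PA × ℕ => HubColoring.toDelete x.1 x.2.1 x.2.2) ?_
    (pair hI (pair hh hv))
  unfold HubColoring.toDelete
  repeat' (with_reducible first
    | apply id | apply fst | apply snd | apply or | apply beq | apply col | apply const
    | apply not | apply allowed | apply any | apply range | apply and | apply adj)

theorem solution (d s : ℕ) {I : α → Inst} {f : α → PA} (hI : PolyTime I) (hf : PolyTime f) :
    PolyTime (fun a => solution d s (I a) (f a)) := by
  refine (comp (g := fun x : Inst × PA => HubColoring.solution d s x.1 x.2) ?_ (pair hI hf) :)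
  unfold HubColoring.solution
  repeat' (with_reducible first
    | apply id | apply fst | apply snd | apply map | apply verts | apply toDelete
    | apply completion)

theorem ones {l : α → List Bool} (hl : PolyTime l) : PolyTime (fun a => ones (l a)) := by
  refine comp (g := HubColoring.ones) ?_ hl
  unfold HubColoring.ones
  repeat' (with_reducible first
    | apply id | apply fst | apply snd | apply sum | apply ite | apply const)

end

theorem active : PolyTime active := not (isEmpty (fst (snd id)))

theorem searchStep (d s D K : ℕ) : PolyTime (searchStep d s D K) := by
  unfold HubColoring.searchStep
  repeat' (with_reducible first
    | apply id | apply fst | apply snd | apply ite | apply isEmpty | apply prunable | apply tail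
    | apply le | apply ones | apply solution | apply append | apply children | apply headD
    | apply pair)

theorem searchInit : PolyTime searchInit := by
  unfold HubColoring.searchInit
  repeat' (with_reducible first
    | apply id | apply fst | apply snd | apply map | apply verts | apply const | apply pair)

end PolyTime

/-! ### Association lists -/

section
variable {f h : PA} {u v x d k : ℕ} {l : List ℕ} {g : ℕ → ℕ}

theorem assigned_iff : assigned f v = true ↔ v ∈ f.map Prod.fst := by
  simp [assigned]

@[simp] theorem assigned_append : assigned (h ++ f) v = (assigned h v || assigned f v) := by
  simp [assigned]

theorem col_cons (p : ℕ × ℕ) : col (p :: f) v = if p.1 = v then p.2 else col f v := by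
  by_cases hp : p.1 = v <;> simp [col, hp]

theorem col_cons_eq_update : col ((v, x) :: f) = Function.update (col f) v x := by
  funext u
  rw [col_cons, Function.update_apply]
  simp only [eq_comm]

theorem col_append : col (h ++ f) v = if assigned h v = true then col h v else col f v := by
  induction h with
  | nil => rfl
  | cons p h ih =>
    rw [List.cons_append, col_cons, col_cons, ih]
    by_cases hp : p.1 = v
    · simp [assigned, hp]
    · have h1 : assigned (p :: h) v = assigned h v := by
        rw [assigned, List.any_cons, beq_eq_false_iff_ne.2 hp, Bool.false_or, assigned]
      rw [h1, if_neg hp, if_neg hp]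

theorem col_lt (hd : 0 < d) (hf : ∀ p ∈ f, p.2 < d) : col f v < d := by
  induction f with
  | nil => exact hd
  | cons p f ih =>
    rw [col_cons]
    split
    · exact hf p List.mem_cons_self
    · exact ih fun p hp => hf p (List.mem_cons_of_mem _ hp)

theorem col_map (hv : v ∈ l) : col (l.map fun u => (u, g u)) v = g v := by
  induction l with
  | nil => simp at hv
  | cons a l ih =>
    rw [List.map_cons, col_cons]
    by_cases ha : a = v
    · simp [ha]
    · rw [if_neg ha, ih ((List.mem_cons.1 hv).resolve_left fun e => ha e.symm)]

@[simp] theorem assigned_map : assigned (l.map fun u => (u, g u)) v = decide (v ∈ l) := by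
  rw [Bool.eq_iff_iff, assigned_iff]
  simp

/-- Several pieces may assign `v`, but they agree, so it does not matter which of them comes first.
-/
theorem col_flatMap {ι : Type*} {cs : List ι} {F : ι → PA}
    (h₁ : ∀ c ∈ cs, assigned (F c) v = true → col (F c) v = x)
    (h₂ : ∃ c ∈ cs, assigned (F c) v = true) : col (cs.flatMap F ++ f) v = x := by
  induction cs with
  | nil => simp at h₂
  | cons c cs ih =>
    rw [List.flatMap_cons, List.append_assoc, col_append]
    split
    · rename_i hc
      exact h₁ c List.mem_cons_self hc
    · rename_i hc
      obtain ⟨c', hc', h'⟩ := h₂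
      refine ih (fun c hc => h₁ c (List.mem_cons_of_mem _ hc)) ⟨c', ?_, h'⟩
      exact (List.mem_cons.1 hc').resolve_left fun e => hc (e ▸ h')

theorem map_mem_assigns (hl : l.length ≤ k) (hg : ∀ v ∈ l, g v < d) :
    (l.map fun v => (v, g v)) ∈ assigns d k l := by
  induction k generalizing l with
  | zero =>
    obtain rfl : l = [] := List.length_eq_zero_iff.1 (by omega)
    simp [assigns]
  | succ k ih =>
    cases l with
    | nil => simp [assigns]
    | cons a l =>
      simp only [List.length_cons, Nat.add_le_add_iff_right] at hl
      simp only [assigns, List.isEmpty_cons, Bool.false_eq_true, if_false, List.tail_cons,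
        List.headD_cons, List.mem_flatMap, List.mem_map, List.mem_range]
      exact ⟨_, ih hl fun v hv => hg v (List.mem_cons_of_mem _ hv), g a,
        hg a List.mem_cons_self, rfl⟩

theorem of_mem_assigns (hl : l.length ≤ k) (hh : h ∈ assigns d k l) :
    h.map Prod.fst = l ∧ ∀ p ∈ h, p.2 < d := by
  induction k generalizing l h with
  | zero =>
    obtain rfl : l = [] := List.length_eq_zero_iff.1 (by omega)
    obtain rfl : h = [] := by simpa [assigns] using hh
    simp
  | succ k ih =>
    cases l with
    | nil =>
      obtain rfl : h = [] := by simpa [assigns] using hh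
      simp
    | cons a l =>
      simp only [List.length_cons, Nat.add_le_add_iff_right] at hl
      simp only [assigns, List.isEmpty_cons, Bool.false_eq_true, if_false, List.tail_cons,
        List.headD_cons, List.mem_flatMap, List.mem_map, List.mem_range] at hh
      obtain ⟨h, hh, x, hx, rfl⟩ := hh
      obtain ⟨h1, h2⟩ := ih hl hh
      exact ⟨by simp [h1], by
        intro p hp
        rcases List.mem_cons.1 hp with rfl | hp
        exacts [hx, h2 p hp]⟩

theorem length_assigns (hl : l.length ≤ k) : (assigns d k l).length = d ^ l.length := by
  induction k generalizing l with
  | zero =>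
    obtain rfl : l = [] := List.length_eq_zero_iff.1 (by omega)
    simp [assigns]
  | succ k ih =>
    cases l with
    | nil => simp [assigns]
    | cons a l =>
      simp only [List.length_cons, Nat.add_le_add_iff_right] at hl
      simp [assigns, List.length_flatMap, ih hl, pow_succ]

theorem eq_map_col (hn : (h.map Prod.fst).Nodup) :
    h = (h.map Prod.fst).map fun v => (v, col h v) := by
  induction h with
  | nil => rfl
  | cons p h ih =>
    simp only [List.map_cons, List.nodup_cons] at hn
    simp only [List.map_cons, col_cons, if_true]
    congr 1
    conv_lhs => rw [ih hn.2]
    refine List.map_congr_left fun v hv => ?_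
    rw [if_neg]
    rintro rfl
    exact hn.1 hv

end

theorem mem_tuples {k : ℕ} {U S : List ℕ} :
    S ∈ tuples k U ↔ S.length ≤ k ∧ S.Nodup ∧ ∀ u ∈ S, u ∈ U := by
  induction k generalizing S with
  | zero =>
    simp only [tuples, List.mem_singleton, nonpos_iff_eq_zero, List.length_eq_zero_iff]
    constructor
    · rintro rfl
      simp
    · exact fun h => h.1
  | succ k ih =>
    simp only [tuples, List.mem_append, List.mem_flatMap, List.mem_map, List.mem_filter, ih]
    constructor
    · rintro (⟨h1, h2, h3⟩ | ⟨t, ⟨h1, h2, h3⟩, u, ⟨hu, hut⟩, rfl⟩)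
      · exact ⟨by omega, h2, h3⟩
      · refine ⟨by simpa using h1, ?_, ?_⟩
        · refine List.nodup_cons.2 ⟨?_, h2⟩
          exact fun hu => (by simpa using hut : ∀ x ∈ t, ¬x = u) u hu rfl
        · intro x hx
          rcases List.mem_cons.1 hx with rfl | hx
          exacts [hu, h3 x hx]
    · rintro ⟨h1, h2, h3⟩
      cases S with
      | nil => exact .inl ⟨by simp, h2, h3⟩
      | cons u t =>
        rw [List.nodup_cons] at h2
        exact .inr ⟨t, ⟨by simpa using h1, h2.2, fun x hx => h3 x (List.mem_cons_of_mem _ hx)⟩, u,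
          ⟨h3 u List.mem_cons_self, by simpa using fun x hx (e : x = u) => h2.1 (e ▸ hx)⟩, rfl⟩

/-! ### The cost of a constraint -/

/-- `g'` arises from `g` by recoloring the second part of the constraint. -/
def Recolors (d : ℕ) (c : Con) (g g' : ℕ → ℕ) : Prop :=
  (∀ v, v ∉ c.2 → g' v = g v) ∧ ∀ v ∈ c.2, g' v < d

/-- The least energy of a recoloring. -/
noncomputable def minEnergy (d : ℕ) (I : Inst) (c : Con) (g : ℕ → ℕ) : ℕ :=
  sInf (energy I c '' {g' | Recolors d c g g'})

section
variable {d s D K : ℕ} {I : Inst} {c : Con} {g g' : ℕ → ℕ} {v x : ℕ} {f : PA}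

theorem minEnergy_le (h : Recolors d c g g') : minEnergy d I c g ≤ energy I c g' :=
  Nat.sInf_le ⟨g', h, rfl⟩

theorem exists_minEnergy (hd : 0 < d) (I : Inst) (c : Con) (g : ℕ → ℕ) :
    ∃ g', Recolors d c g g' ∧ energy I c g' = minEnergy d I c g :=
  Nat.sInf_mem (s := energy I c '' {g' | Recolors d c g g'})
    ⟨_, fun v => if v ∈ c.2 then 0 else g v,
      ⟨fun v hv => by simp [hv], fun v hv => by simp [hv, hd]⟩, rfl⟩

theorem energy_congr (h : ∀ v ∈ c.1 ++ c.2, g v = g' v) : energy I c g = energy I c g' := by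
  unfold energy
  congr 2
  · refine List.map_congr_left fun v hv => ?_
    rw [h v (List.mem_append_right _ hv)]
  · refine List.map_congr_left fun v hv => ?_
    rw [h v hv]
    congr 2
    refine List.map_congr_left fun u hu => ?_
    rw [h u hu]

/-- An optimal recoloring of `g'` can be transplanted to `g`: the energy depends only on the
vertices of the constraint, and on its first part the two colorings agree. -/
theorem minEnergy_le_of_agree (hd : 0 < d) (h : ∀ v ∈ c.1, g v = g' v) :
    minEnergy d I c g ≤ minEnergy d I c g' := by
  obtain ⟨g₁, h1, h2⟩ := exists_minEnergy hd I c g'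
  rw [← h2]
  classical
  rw [energy_congr (g := g₁) (g' := fun v => if v ∈ c.2 then g₁ v else g v)]
  · exact minEnergy_le ⟨fun v hv => by simp [hv], fun v hv => by simpa [hv] using h1.2 v hv⟩
  · intro v hv
    by_cases hv2 : v ∈ c.2
    · simp [hv2]
    · simp only [hv2, if_false]
      rw [h v ((List.mem_append.1 hv).resolve_right hv2), h1.1 v hv2]

theorem minEnergy_congr (hd : 0 < d) (h : ∀ v ∈ c.1, g v = g' v) :
    minEnergy d I c g = minEnergy d I c g' :=
  le_antisymm (minEnergy_le_of_agree hd h) (minEnergy_le_of_agree hd fun v hv => (h v hv).symm)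

theorem allowed_zero : allowed I v 0 = true := rfl

/-- Color 0 is on every list and is never part of a monochromatic edge, so it can only remove
violations. The deletion of `v` is not charged, because only deletions in the second part are. -/
theorem energy_update_le (hv : v ∉ c.2) : energy I c (Function.update g v 0) ≤ energy I c g := by
  unfold energy
  refine Nat.add_le_add (le_of_eq ?_) (List.sum_le_sum fun u _ => Nat.add_le_add ?_
    (List.sum_le_sum fun w _ => ?_))
  · congr 1
    refine List.map_congr_left fun u hu => ?_
    rw [Function.update_of_ne (by rintro rfl; exact hv hu)]
  · by_cases hu : u = v
    · subst hu
      simp [allowed_zero]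
    · rw [Function.update_of_ne hu]
  · by_cases hu : u = v
    · subst hu
      simp
    · rw [Function.update_of_ne hu]
      by_cases hw : w = v
      · subst hw
        simp only [Function.update_self]
        by_cases h0 : g u = 0
        · simp [h0]
        · rw [show ((0 : ℕ) == g u) = false from beq_eq_false_iff_ne.2 (Ne.symm h0)]
          simp
      · rw [Function.update_of_ne hw]

theorem minEnergy_update_le (hd : 0 < d) (hv : v ∉ c.2) :
    minEnergy d I c (Function.update g v 0) ≤ minEnergy d I c g := by
  obtain ⟨g₁, h1, h2⟩ := exists_minEnergy hd I c g
  rw [← h2]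
  refine (minEnergy_le (g' := Function.update g₁ v 0) ⟨fun u hu => ?_, fun u hu => ?_⟩).trans
    (energy_update_le hv)
  · by_cases h : u = v
    · simp [h]
    · rw [Function.update_of_ne h, Function.update_of_ne h, h1.1 u hu]
  · rw [Function.update_of_ne (by rintro rfl; exact hv hu)]
    exact h1.2 u hu

theorem recolors_assigns {h : PA} (hc : c.2.length ≤ s) (hh : h ∈ assigns d s c.2) :
    Recolors d c (col f) (col (h ++ f)) := by
  obtain ⟨h1, h2⟩ := of_mem_assigns hc hh
  have h3 : ∀ v, assigned h v = true ↔ v ∈ c.2 := fun v => by rw [assigned_iff, h1]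
  refine ⟨fun v hv => ?_, fun v hv => ?_⟩
  · rw [col_append, if_neg (by rwa [h3])]
  · rw [col_append, if_pos (by rwa [h3])]
    refine col_lt (Nat.pos_of_ne_zero ?_) h2
    rintro rfl
    rw [← h1] at hv
    obtain ⟨p, hp, -⟩ := List.mem_map.1 hv
    exact absurd (h2 p hp) (by omega)

/-- The list of minimizers is nonempty, so the default value in `best` is never used. -/
theorem best_spec (hd : 0 < d) (hc : c.2.length ≤ s) : best d s I c f ∈ assigns d s c.2 ∧
    ∀ h ∈ assigns d s c.2, energy I c (col (best d s I c f ++ f)) ≤ energy I c (col (h ++ f)) := by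
  have hne : (assigns d s c.2).toFinset.Nonempty :=
    ⟨_, List.mem_toFinset.2 (map_mem_assigns (g := fun _ => 0) hc fun _ _ => hd)⟩
  obtain ⟨h, hh, hmin⟩ := Finset.exists_min_image _ (fun h => energy I c (col (h ++ f))) hne
  have hmem : h ∈ (assigns d s c.2).filter fun h => (assigns d s c.2).all fun h' =>
      decide (energy I c (col (h ++ f)) ≤ energy I c (col (h' ++ f))) := by
    simp only [List.mem_filter, List.all_eq_true, decide_eq_true_eq]
    exact ⟨List.mem_toFinset.1 hh, fun h' hh' => hmin h' (List.mem_toFinset.2 hh')⟩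
  have hb : best d s I c f ∈ (assigns d s c.2).filter fun h => (assigns d s c.2).all fun h' =>
      decide (energy I c (col (h ++ f)) ≤ energy I c (col (h' ++ f))) := by
    unfold best
    revert hmem
    generalize (assigns d s c.2).filter _ = l
    intro hl
    cases l with
    | nil => simp at hl
    | cons a l => simp
  simpa only [List.mem_filter, List.all_eq_true, decide_eq_true_eq] using hb

/-- On the vertices of the constraint every recoloring comes from a member of `assigns`, so the
exhaustive search finds the minimum. -/
theorem cost_eq (hd : 0 < d) (hc : c.2.length ≤ s) :
    cost d s I c f = minEnergy d I c (col f) := by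
  obtain ⟨h1, h2⟩ := best_spec (I := I) (f := f) hd hc
  refine le_antisymm ?_ (minEnergy_le (recolors_assigns hc h1))
  obtain ⟨g, hg, hge⟩ := exists_minEnergy hd I c (col f)
  rw [← hge]
  refine (h2 _ (map_mem_assigns (g := g) hc hg.2)).trans (le_of_eq (energy_congr fun v _ => ?_))
  rw [col_append, assigned_map]
  by_cases hv : v ∈ c.2
  · simp [hv, col_map hv]
  · simp [hv, hg.1 v hv]

/-- The properties of the constraints that come from the hub. -/
structure Bounded (s D : ℕ) (I : Inst) : Prop where
  left_length : ∀ c ∈ constraints s I, c.1.length ≤ D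
  right_length : ∀ c ∈ constraints s I, c.2.length ≤ s

theorem mem_hubs : v ∈ hubs I ↔ v < I.1.length ∧ bit I.2.2 v = true := by
  simp [hubs, verts]

theorem mem_outer : v ∈ outer I ↔ v < I.1.length ∧ bit I.2.2 v = false := by
  simp [outer, verts]

theorem nodup_hubs : (hubs I).Nodup := List.nodup_range.filter _

theorem nodup_outer : (outer I).Nodup := List.nodup_range.filter _

theorem near_subset {k w u : ℕ} (hu : u ∈ near I k w) : u ∈ outer I := by
  cases k <;> exact (List.mem_filter.1 hu).1

theorem mem_comps {C : List ℕ} : C ∈ comps s I ↔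
    ∃ w ∈ outer I, (near I s w).headD 0 = w ∧ near I s w = C := by
  simp [comps, and_assoc]

theorem mem_constraints : c ∈ constraints s I ↔ (∃ C ∈ comps s I, (scope I C, C) = c) ∨
    ∃ u ∈ hubs I, ∃ v ∈ hubs I, ([u, v], []) = c := by
  simp [constraints]

theorem left_subset (hc : c ∈ constraints s I) (hv : v ∈ c.1) : v ∈ hubs I := by
  rcases mem_constraints.1 hc with ⟨C, -, rfl⟩ | ⟨u, hu, w, hw, rfl⟩
  · exact (List.mem_filter.1 hv).1
  · rcases List.mem_pair.1 hv with rfl | rfl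
    exacts [hu, hw]

theorem right_subset (hc : c ∈ constraints s I) (hv : v ∈ c.2) : v ∈ outer I := by
  rcases mem_constraints.1 hc with ⟨C, hC, rfl⟩ | ⟨u, hu, w, hw, rfl⟩
  · obtain ⟨w, -, -, rfl⟩ := mem_comps.1 hC
    exact near_subset hv
  · simp at hv

theorem not_mem_right (hc : c ∈ constraints s I) (hv : v ∈ hubs I) : v ∉ c.2 := fun h => by
  have h1 := (mem_outer.1 (right_subset hc h)).2
  rw [(mem_hubs.1 hv).2] at h1
  exact absurd h1 (by simp)

/-! ### Pruning is sound -/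

/-- The value of an assignment of the hub. -/
noncomputable def objective (d s : ℕ) (I : Inst) (g : ℕ → ℕ) : ℕ :=
  ((hubs I).map fun v => if g v = 0 then 1 else 0).sum +
    ((constraints s I).map fun c => minEnergy d I c g).sum

/-- The terms of `v` are added crosswise to avoid subtraction of natural numbers. -/
theorem sum_map_update (F : ℕ → ℕ) {l : List ℕ} (hl : l.Nodup) (hv : v ∈ l) :
    (l.map fun u => F (Function.update g v x u)).sum + F (g v) =
      (l.map fun u => F (g u)).sum + F x := by
  induction l with
  | nil => simp at hv
  | cons a l ih =>
    rw [List.nodup_cons] at hl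
    simp only [List.map_cons, List.sum_cons]
    rcases List.mem_cons.1 hv with rfl | hv
    · have h : (l.map fun u => F (Function.update g v x u)) = l.map fun u => F (g u) :=
        List.map_congr_left fun u hu => by
          rw [Function.update_of_ne (by rintro rfl; exact hl.1 hu)]
      rw [h, Function.update_self]
      omega
    · have := ih hl.2 hv
      rw [Function.update_of_ne (by rintro rfl; exact hl.1 hv)]
      omega

/-- The two halves of `dominated` cover all constraints. The determined ones cost the same under `g`
as under `f`, and their total together with the price of `v` does not rise. Each other constraint
was tested against all colorings of its first part, hence against `g`. -/
theorem objective_update_le (hd : 0 < d) (hI : Bounded s D I)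
    (hdom : dominated d s D I f v x = true)
    (hv : v ∈ hubs I) (hfv : assigned f v = true) (hg : ∀ u, g u < d)
    (hfg : ∀ u, assigned f u = true → g u = col f u) :
    objective d s I (Function.update g v x) ≤ objective d s I g := by
  simp only [dominated, Bool.and_eq_true, decide_eq_true_eq, List.all_eq_true,
    Bool.or_eq_true] at hdom
  obtain ⟨h1, h2⟩ := hdom
  unfold localCost at h1
  have h3 := sum_map_update (g := g) (x := x) (fun a => if a = 0 then 1 else 0) nodup_hubs hv
  have h4 : ((constraints s I).map fun c => minEnergy d I c (Function.update g v x)).sum +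
      ((constraints s I).map fun c => if determined c f = true then cost d s I c f else 0).sum ≤
      ((constraints s I).map fun c => minEnergy d I c g).sum + ((constraints s I).map fun c =>
        if determined c f = true then cost d s I c ((v, x) :: f) else 0).sum := by
    rw [← List.sum_map_add, ← List.sum_map_add]
    refine List.sum_le_sum fun c hc => ?_
    rw [cost_eq hd (hI.right_length c hc), cost_eq hd (hI.right_length c hc), col_cons_eq_update]
    have hext : ∀ {f' : PA}, (∀ u ∈ c.1, g u = col f' u) → ∀ u ∈ c.1,
        Function.update g v x u = Function.update (col f') v x u := by
      intro f' h u hu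
      rw [Function.update_apply, Function.update_apply, h u hu]
    by_cases hdet : determined c f = true
    · have h5 : ∀ u ∈ c.1, g u = col f u := fun u hu =>
        hfg u (by simpa using List.all_eq_true.1 hdet u hu)
      rw [if_pos hdet, if_pos hdet, minEnergy_congr hd (hext h5), minEnergy_congr hd h5, add_comm]
    · rw [if_neg hdet, if_neg hdet]
      -- Use the test for the restriction of `g` to the first part; where `f` takes precedence over
      -- it, `g` agrees with `f`.
      have h6 := (h2 c hc).resolve_left hdet _
        (map_mem_assigns (g := g) (hI.left_length c hc) fun u _ => hg u)
      rw [List.cons_append, cost_eq hd (hI.right_length c hc), cost_eq hd (hI.right_length c hc),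
        col_cons_eq_update] at h6
      have h5 : ∀ u ∈ c.1, g u = col (f ++ c.1.map fun u => (u, g u)) u := by
        intro u hu
        rw [col_append]
        split
        · rename_i h
          exact hfg u h
        · rw [col_map hu]
      rw [minEnergy_congr hd (hext h5), minEnergy_congr hd h5]
      simpa using h6
  simp only [beq_iff_eq, col_cons_eq_update, Function.update_self, ← hfg v hfv] at h1
  unfold objective
  omega

end

/-! ### There is always something to prune -/

/-- Assignments of small sets that are pairwise in conflict are few. -/
theorem card_le_pow_of_conflict {κ ι : Type*} [Fintype ι] [DecidableEq ι] {d D : ℕ} (hd : 0 < d)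
    (R : Finset κ) (S : κ → Finset ι) (g : κ → ι → Fin d) (hS : ∀ c ∈ R, (S c).card ≤ D)
    (hR : ∀ c ∈ R, ∀ c' ∈ R, c ≠ c' → ∃ u, u ∈ S c ∧ u ∈ S c' ∧ g c u ≠ g c' u) :
    R.card ≤ d ^ D := by
  classical
  -- The cube of `c` consists of the total assignments that agree with `g c` on `S c`. It contains
  -- at least the fraction `1 / d ^ D` of all assignments, and a conflict makes two cubes disjoint.
  set cube : κ → Finset (ι → Fin d) := fun c =>
    Fintype.piFinset fun i => if i ∈ S c then {g c i} else Finset.univ with hcube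
  have hcard : ∀ c ∈ R, d ^ Fintype.card ι ≤ d ^ D * (cube c).card := by
    intro c hc
    have h : (cube c).card * d ^ (S c).card = d ^ Fintype.card ι := by
      have h1 : ∏ i, (if i ∈ S c then d else 1) = d ^ (S c).card := by
        rw [Finset.prod_ite_mem, Finset.univ_inter, Finset.prod_const]
      rw [hcube, Fintype.card_piFinset, ← h1, ← Finset.prod_mul_distrib, ← Finset.card_univ,
        ← Finset.prod_const]
      refine Finset.prod_congr rfl fun i _ => ?_
      by_cases hi : i ∈ S c <;> simp [hi]
    rw [← h, mul_comm]
    exact Nat.mul_le_mul_right _ (Nat.pow_le_pow_right hd (hS c hc))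
  have hdisj : (R.biUnion cube).card = ∑ c ∈ R, (cube c).card := by
    refine Finset.card_biUnion fun c hc c' hc' hne => Finset.disjoint_left.2 fun h h1 h2 => ?_
    obtain ⟨u, hu, hu', hgu⟩ := hR c hc c' hc' hne
    rw [hcube, Fintype.mem_piFinset] at h1 h2
    have h3 := h1 u
    have h4 := h2 u
    simp only [hu, hu', if_true, Finset.mem_singleton] at h3 h4
    exact hgu (h3.symm.trans h4)
  have hle : (R.biUnion cube).card ≤ d ^ Fintype.card ι := by
    simpa using Finset.card_le_univ (R.biUnion cube)
  have : R.card * d ^ Fintype.card ι ≤ d ^ D * d ^ Fintype.card ι :=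
    calc R.card * d ^ Fintype.card ι = ∑ c ∈ R, d ^ Fintype.card ι := by simp
      _ ≤ ∑ c ∈ R, d ^ D * (cube c).card := Finset.sum_le_sum hcard
      _ = d ^ D * (R.biUnion cube).card := by rw [hdisj, Finset.mul_sum]
      _ ≤ _ := Nat.mul_le_mul_left _ hle
  exact Nat.le_of_mul_le_mul_right this (by positivity)

section
variable {d s D K : ℕ} {I : Inst} {v x : ℕ} {f : PA}

theorem mem_free {u : ℕ} : u ∈ free I f ↔ u ∈ hubs I ∧ assigned f u = false := by
  simp [free]

theorem prunable_ne_nil {S : List ℕ} {τ : ℕ → ℕ} (hS : S.Nodup) (hSf : ∀ u ∈ S, u ∈ free I f)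
    (hSK : S.length ≤ K) (hv : v ∈ S) (hx : x < d) (hτ : ∀ u ∈ S, τ u < d) (hne : τ v ≠ x)
    (h : dominated d s D I ((S.map fun u => (u, τ u)) ++ f) v x = true) :
    prunable d s D K I f ≠ [] := by
  refine List.ne_nil_of_mem (a := (S.map fun u => (u, τ u), v, x)) ?_
  simp only [prunable, changes, List.mem_filter, List.mem_flatMap, List.mem_map, List.mem_range,
    Bool.and_eq_true, Bool.not_eq_true', beq_eq_false_iff_ne]
  exact ⟨⟨S, mem_tuples.2 ⟨hSK, hS, hSf⟩, _, map_mem_assigns hSK hτ, v, hv, x, hx, rfl⟩,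
    by rwa [col_map hv], h⟩

/-- Passes from the executable test to conditions on `minEnergy`. The second condition, for all
colorings that extend `f`, includes the finitely many colorings that are tested. -/
theorem dominated_of (hd : 0 < d) (hI : Bounded s D I) (hf : ∀ p ∈ f, p.2 < d)
    (h₁ : ((constraints s I).map fun c =>
        if determined c f = true then minEnergy d I c (Function.update (col f) v x) else 0).sum +
        (if x = 0 then 1 else 0) ≤ ((constraints s I).map fun c =>
        if determined c f = true then minEnergy d I c (col f) else 0).sum +
        if col f v = 0 then 1 else 0)
    (h₂ : ∀ c ∈ constraints s I, determined c f = false → ∀ g : ℕ → ℕ,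
      (∀ u, assigned f u = true → g u = col f u) → (∀ u, g u < d) →
        minEnergy d I c (Function.update g v x) ≤ minEnergy d I c g) :
    dominated d s D I f v x = true := by
  simp only [dominated, Bool.and_eq_true, decide_eq_true_eq, List.all_eq_true,
    Bool.or_eq_true]
  constructor
  · have e₁ : ((constraints s I).map fun c =>
        if determined c f = true then cost d s I c ((v, x) :: f) else 0) =
        (constraints s I).map fun c =>
          if determined c f = true then minEnergy d I c (Function.update (col f) v x) else 0 :=
      List.map_congr_left fun c hc => by rw [cost_eq hd (hI.right_length c hc), col_cons_eq_update]
    have e₂ : ((constraints s I).map fun c => if determined c f = true then cost d s I c f else 0) =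
        (constraints s I).map fun c =>
          if determined c f = true then minEnergy d I c (col f) else 0 :=
      List.map_congr_left fun c hc => by rw [cost_eq hd (hI.right_length c hc)]
    rw [localCost, localCost, e₁, e₂]
    simpa [col_cons] using h₁
  · intro c hc
    by_cases hdet : determined c f = true
    · exact .inl hdet
    · refine .inr fun h hh => ?_
      rw [List.cons_append, cost_eq hd (hI.right_length c hc), cost_eq hd (hI.right_length c hc),
        col_cons_eq_update]
      refine h₂ c hc (by simpa using hdet) _ (fun u hu => ?_) (fun u => col_lt hd fun p hp => ?_)
      · rw [col_append, if_pos hu]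
      · rcases List.mem_append.1 hp with hp | hp
        exacts [hf p hp, (of_mem_assigns (hI.left_length c hc) hh).2 p hp]

/-- The cost of the constraint `c` depends on the color of `v` for some extension of `f`. -/
def Relevant (d : ℕ) (I : Inst) (f : PA) (v : ℕ) (c : Con) : Prop :=
  ∃ g : ℕ → ℕ, (∀ u, assigned f u = true → g u = col f u) ∧ (∀ u, g u < d) ∧
    minEnergy d I c (Function.update g v 0) < minEnergy d I c g

/-- Coloring the free vertices of both constraints by the two witnesses realizes both savings at
once. Deleting `v` then costs 1 and saves at least 1 in each of the two constraints, while no other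
constraint becomes more expensive, by `minEnergy_update_le`. -/
theorem prunable_of_compatible (hd : 0 < d) (hI : Bounded s D I) (hK : 2 * D ≤ K)
    (hf : ∀ p ∈ f, p.2 < d) (hv : v ∈ free I f) {c₁ c₂ : Con} (hc₁ : c₁ ∈ constraints s I)
    (hc₂ : c₂ ∈ constraints s I) (hne : c₁ ≠ c₂) {g₁ g₂ : ℕ → ℕ}
    (hg₁ : ∀ u, assigned f u = true → g₁ u = col f u)
    (hg₂ : ∀ u, assigned f u = true → g₂ u = col f u)
    (hl₁ : ∀ u, g₁ u < d) (hl₂ : ∀ u, g₂ u < d)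
    (hm₁ : minEnergy d I c₁ (Function.update g₁ v 0) < minEnergy d I c₁ g₁)
    (hm₂ : minEnergy d I c₂ (Function.update g₂ v 0) < minEnergy d I c₂ g₂)
    (hcomp : ∀ u ∈ c₁.1, u ∈ c₂.1 → g₁ u = g₂ u) : prunable d s D K I f ≠ [] := by
  classical
  obtain ⟨hvh, hvf⟩ := mem_free.1 hv
  have hvc₁ : v ∈ c₁.1 := by
    by_contra h
    exact hm₁.ne (minEnergy_congr hd fun u hu => by
      rw [Function.update_of_ne (by rintro rfl; exact h hu)])
  -- The witnesses are glued; by `hcomp` the choice on common vertices does not matter.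
  set τ : ℕ → ℕ := fun u => if u ∈ c₁.1 then g₁ u else g₂ u with hτ
  set S := ((c₁.1 ++ c₂.1).filter fun u => !assigned f u).dedup with hS
  have hmem : ∀ u, u ∈ S ↔ (u ∈ c₁.1 ∨ u ∈ c₂.1) ∧ assigned f u = false := fun u => by
    rw [hS, List.mem_dedup, List.mem_filter, List.mem_append]
    simp
  have hvS : v ∈ S := (hmem v).2 ⟨.inl hvc₁, hvf⟩
  have hSf : ∀ u ∈ S, u ∈ free I f := fun u hu => by
    obtain ⟨h1, h2⟩ := (hmem u).1 hu
    exact mem_free.2 ⟨h1.elim (left_subset hc₁) (left_subset hc₂), h2⟩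
  have hSK : S.length ≤ K := by
    refine (List.dedup_sublist _).length_le.trans ((List.length_filter_le _ _).trans ?_)
    rw [List.length_append]
    have := hI.left_length c₁ hc₁
    have := hI.left_length c₂ hc₂
    omega
  have hτlt : ∀ u, τ u < d := fun u => by
    rw [hτ]
    dsimp only
    split
    exacts [hl₁ u, hl₂ u]
  set F : PA := (S.map fun u => (u, τ u)) ++ f with hF
  have hcol : ∀ u, u ∈ S → col F u = τ u := fun u hu => by
    rw [hF, col_append, assigned_map, if_pos (by simpa using hu), col_map hu]
  have hcol' : ∀ u, assigned f u = true → col F u = col f u := fun u hu => by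
    rw [hF, col_append, assigned_map, if_neg]
    simp only [decide_eq_true_eq, hmem, hu]
    simp
  have hF₁ : ∀ u ∈ c₁.1, col F u = g₁ u := fun u hu => by
    cases hfu : assigned f u with
    | false => rw [hcol u ((hmem u).2 ⟨.inl hu, hfu⟩), hτ]; simp [hu]
    | true => rw [hcol' u hfu, hg₁ u hfu]
  have hF₂ : ∀ u ∈ c₂.1, col F u = g₂ u := fun u hu => by
    cases hfu : assigned f u with
    | false =>
      rw [hcol u ((hmem u).2 ⟨.inr hu, hfu⟩), hτ]
      dsimp only
      split
      · rename_i h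
        exact hcomp u h hu
      · rfl
    | true => rw [hcol' u hfu, hg₂ u hfu]
  have hdet : ∀ c, (c = c₁ ∨ c = c₂) → determined c F = true := by
    intro c hc
    refine List.all_eq_true.2 fun u hu => ?_
    rw [hF, assigned_append, assigned_map, Bool.or_eq_true, decide_eq_true_eq, hmem]
    cases hfu : assigned f u with
    | false => rcases hc with rfl | rfl <;> simp [hu]
    | true => simp
  -- If `v` had color 0 already, the update would change nothing and could not save anything.
  have hv0 : τ v ≠ 0 := by
    intro h0
    refine hm₁.ne (congrArg _ ?_)
    have : g₁ v = 0 := by simpa [hτ, hvc₁] using h0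
    exact Function.update_eq_self_iff.2 this.symm
  refine prunable_ne_nil (List.nodup_dedup _) hSf hSK hvS hd (fun u _ => hτlt u) hv0
    (dominated_of hd hI ?_ ?_ ?_)
  · intro p hp
    rcases List.mem_append.1 hp with hp | hp
    · obtain ⟨u, -, rfl⟩ := List.mem_map.1 hp
      exact hτlt u
    · exact hf p hp
  · rw [← hF]
    have hone : ∀ c ∈ constraints s I,
        1 ≤ ((constraints s I).map fun c' => if c' = c then 1 else 0).sum := fun c hc =>
      List.single_le_sum (by simp) _ (List.mem_map.2 ⟨c, hc, by simp⟩)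
    have h1 := hone c₁ hc₁
    have h2 := hone c₂ hc₂
    -- The indicators record the savings at `c₁` and `c₂`; by `h1` and `h2` each of them sums to at
    -- least 1.
    have h3 : ((constraints s I).map fun c =>
        (if determined c F = true then minEnergy d I c (Function.update (col F) v 0) else 0) +
          ((if c = c₁ then 1 else 0) + if c = c₂ then 1 else 0)).sum ≤
        ((constraints s I).map fun c =>
          if determined c F = true then minEnergy d I c (col F) else 0).sum := by
      refine List.sum_le_sum fun c hc => ?_
      have hup : ∀ {c' : Con} {g' : ℕ → ℕ}, (∀ u ∈ c'.1, col F u = g' u) → ∀ u ∈ c'.1,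
          Function.update (col F) v 0 u = Function.update g' v 0 u := by
        intro c' g' h u hu
        rw [Function.update_apply, Function.update_apply, h u hu]
      by_cases e₁ : c = c₁
      · rw [if_pos (hdet c (.inl e₁)), if_pos (hdet c (.inl e₁)), if_pos e₁,
          if_neg (fun e₂ => hne (e₁.symm.trans e₂)), e₁, minEnergy_congr hd (hup hF₁),
          minEnergy_congr hd hF₁]
        omega
      · by_cases e₂ : c = c₂
        · rw [if_pos (hdet c (.inr e₂)), if_pos (hdet c (.inr e₂)), if_pos e₂, if_neg e₁, e₂,
            minEnergy_congr hd (hup hF₂), minEnergy_congr hd hF₂]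
          omega
        · rw [if_neg e₁, if_neg e₂]
          split
          · simpa using minEnergy_update_le hd (not_mem_right hc hvh)
          · simp
    rw [List.sum_map_add, List.sum_map_add] at h3
    simp only [if_true]
    omega
  · exact fun c hc _ g _ _ => minEnergy_update_le hd (not_mem_right hc hvh)

/-- Fix `v` and all free vertices of relevant constraints, at most `1 + R.card * D` in total. A
constraint that stays undetermined is not relevant: deleting `v` can neither lower nor raise its
cost, so this cost does not depend on the color of `v`. What remains is a function of that color
alone, and comparing two of its values shows which color can be replaced by the other. -/
theorem prunable_of_few_relevant (hd : 2 ≤ d) (hI : Bounded s D I) (hf : ∀ p ∈ f, p.2 < d)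
    (hv : v ∈ free I f) (R : Finset Con)
    (hR : ∀ c, c ∈ R ↔ c ∈ constraints s I ∧ Relevant d I f v c)
    (hK : 1 + R.card * D ≤ K) : prunable d s D K I f ≠ [] := by
  classical
  obtain ⟨hvh, hvf⟩ := mem_free.1 hv
  have hd0 : 0 < d := by omega
  set S := (v :: (R.toList.flatMap fun c => c.1).filter fun u => !assigned f u).dedup with hS
  have hmem : ∀ u, u ∈ S ↔ u = v ∨ (∃ c ∈ R, u ∈ c.1) ∧ assigned f u = false := fun u => by
    rw [hS, List.mem_dedup, List.mem_cons, List.mem_filter, List.mem_flatMap]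
    simp
  have hvS : v ∈ S := (hmem v).2 (.inl rfl)
  have hSfree : ∀ u ∈ S, assigned f u = false := fun u hu =>
    ((hmem u).1 hu).elim (fun e => e ▸ hvf) fun h => h.2
  have hSf : ∀ u ∈ S, u ∈ free I f := fun u hu => by
    rcases (hmem u).1 hu with rfl | ⟨⟨c, hc, huc⟩, h2⟩
    · exact hv
    · exact mem_free.2 ⟨left_subset ((hR c).1 hc).1 huc, h2⟩
  have hSK : S.length ≤ K := by
    refine (List.dedup_sublist _).length_le.trans (le_trans ?_ hK)
    rw [List.length_cons, add_comm]
    refine Nat.add_le_add_left ((List.length_filter_le _ _).trans ?_) _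
    rw [List.length_flatMap]
    have := List.sum_le_card_nsmul (R.toList.map fun c => c.1.length) D (by
      intro k hk
      obtain ⟨c, hc, rfl⟩ := List.mem_map.1 hk
      exact hI.left_length c ((hR c).1 (Finset.mem_toList.1 hc)).1)
    simpa using this
  -- `v` gets the color `y`; color 0 for the other fixed vertices is an arbitrary choice.
  set F : ℕ → PA := fun y => (S.map fun u => (u, if u = v then y else 0)) ++ f with hF
  have hlt : ∀ y, y < d → ∀ p ∈ F y, p.2 < d := by
    intro y hy p hp
    rcases List.mem_append.1 hp with hp | hp
    · obtain ⟨u, -, rfl⟩ := List.mem_map.1 hp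
      dsimp only
      split <;> omega
    · exact hf p hp
  have hdet : ∀ y c, determined c (F y) = determined c (F 0) := by
    intro y c
    simp only [determined, hF, assigned_append, assigned_map]
  have hcolv : ∀ y, col (F y) v = y := fun y => by
    rw [hF]
    dsimp only
    rw [col_append, assigned_map, if_pos (by simpa using hvS), col_map hvS, if_pos rfl]
  have hupd : ∀ x y, Function.update (col (F y)) v x = col (F x) := by
    intro x y
    funext u
    by_cases hu : u = v
    · subst hu
      rw [Function.update_self, hcolv]
    · rw [Function.update_of_ne hu, hF]
      dsimp only
      rw [col_append, col_append, assigned_map, assigned_map]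
      by_cases huS : u ∈ S
      · simp [huS, col_map huS, hu]
      · simp [huS]
  have hcol' : ∀ y u, assigned f u = true → col (F y) u = col f u := fun y u hu => by
    rw [hF]
    dsimp only
    rw [col_append, assigned_map, if_neg]
    simp only [decide_eq_true_eq]
    intro h
    simp [hSfree u h] at hu
  -- The part of the objective that can change with the color `y` of `v`.
  set val : ℕ → ℕ := fun y => ((constraints s I).map fun c =>
    if determined c (F 0) = true then minEnergy d I c (col (F y)) else 0).sum +
      if y = 0 then 1 else 0 with hval
  have key : ∀ x y, x < d → y < d → y ≠ x → val x ≤ val y → prunable d s D K I f ≠ [] := by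
    intro x y hx hy hne hle
    refine prunable_ne_nil (τ := fun u => if u = v then y else 0) (List.nodup_dedup _) hSf hSK hvS
      hx (fun u _ => by split <;> omega) (by simpa using hne)
      (dominated_of hd0 hI (hlt y hy) ?_ ?_)
    · change ((constraints s I).map fun c => if determined c (F y) = true then
        minEnergy d I c (Function.update (col (F y)) v x) else 0).sum + _ ≤
        ((constraints s I).map fun c => if determined c (F y) = true then
        minEnergy d I c (col (F y)) else 0).sum + if col (F y) v = 0 then 1 else 0
      simpa only [hdet y, hupd, hcolv] using hle
    · intro c hc hdc g hg hgd
      have hnR : ¬Relevant d I f v c := by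
        intro hrel
        have : determined c (F y) = true := by
          refine List.all_eq_true.2 fun u hu => ?_
          rw [hF, assigned_append, assigned_map, Bool.or_eq_true, decide_eq_true_eq, hmem]
          cases hfu : assigned f u with
          | false => exact .inl (.inr ⟨⟨c, (hR c).2 ⟨hc, hrel⟩, hu⟩, rfl⟩)
          | true => exact .inr rfl
        exact absurd (this.symm.trans hdc) (by simp)
      refine le_trans ?_ (minEnergy_update_le hd0 (not_mem_right hc hvh))
      -- If `x` were more expensive than 0, the coloring with `x` at `v` would witness that `c` is
      -- relevant.
      by_contra hlt'
      refine hnR ⟨Function.update g v x, fun u hu => ?_, fun u => ?_, ?_⟩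
      · have huv : u ≠ v := by
          rintro rfl
          simp [hvf] at hu
        rw [Function.update_of_ne huv, hg u, hcol' y u hu]
        rw [assigned_append, hu, Bool.or_true]
      · rw [Function.update_apply]
        split
        exacts [hx, hgd u]
      · rw [Function.update_idem]
        exact not_le.1 hlt'
  -- Two colors suffice for the comparison; this is where `2 ≤ d` is needed.
  rcases le_total (val 0) (val 1) with h | h
  · exact key 0 1 (by omega) (by omega) (by omega) h
  · exact key 1 0 (by omega) (by omega) (by omega) h

/-- As long as not all hub vertices are assigned, some assignment can be pruned. -/
theorem prunable_ne_nil_of_free (hd : 2 ≤ d) (hI : Bounded s D I) (hK : 2 * D ≤ K)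
    (hK' : 1 + d ^ D * D ≤ K) (hf : ∀ p ∈ f, p.2 < d) (hfree : free I f ≠ []) :
    prunable d s D K I f ≠ [] := by
  classical
  obtain ⟨v, hv⟩ := List.exists_mem_of_ne_nil _ hfree
  set R : Finset Con := (constraints s I).toFinset.filter (Relevant d I f v) with hR
  have hmem : ∀ c, c ∈ R ↔ c ∈ constraints s I ∧ Relevant d I f v c := fun c => by simp [hR]
  by_cases hcard : R.card ≤ d ^ D
  · refine prunable_of_few_relevant hd hI hf hv R hmem (le_trans ?_ hK')
    gcongr
  -- With nothing to prune, `prunable_of_compatible` puts any two witnesses in conflict, which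
  -- bounds the number of relevant constraints after all.
  · by_contra hnil
    refine hcard ?_
    have hrel : ∀ c : Con, ∃ g : ℕ → ℕ, c ∈ R → (∀ u, assigned f u = true → g u = col f u) ∧
        (∀ u, g u < d) ∧ minEnergy d I c (Function.update g v 0) < minEnergy d I c g := by
      intro c
      by_cases hc : c ∈ R
      · obtain ⟨g, hg⟩ := ((hmem c).1 hc).2
        exact ⟨g, fun _ => hg⟩
      · exact ⟨fun _ => 0, fun h => absurd h hc⟩
    choose g hg using hrel
    refine card_le_pow_of_conflict (ι := Fin I.1.length) (d := d) (by omega) R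
      (fun c => Finset.univ.filter fun u => u.1 ∈ c.1)
      -- The remainder only serves to land in `Fin d`; for the members of `R` these colors are below
      -- `d` anyway.
      (fun c u => ⟨g c u % d, Nat.mod_lt _ (by omega)⟩) (fun c hc => ?_) fun c hc c' hc' hne => ?_
    · refine le_trans ?_ (hI.left_length c ((hmem c).1 hc).1)
      refine le_trans ?_ (List.toFinset_card_le c.1)
      exact Finset.card_le_card_of_injOn Fin.val (fun u hu => by simpa using hu)
        (Fin.val_injective.injOn)
    · by_contra hno
      push Not at hno
      refine absurd hnil (prunable_of_compatible (by omega) hI hK hf hv ((hmem c).1 hc).1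
        ((hmem c').1 hc').1 hne (hg c hc).1 (hg c' hc').1 (hg c hc).2.1 (hg c' hc').2.1
        (hg c hc).2.2 (hg c' hc').2.2 fun u hu hu' => ?_)
      have h := hno ⟨u, (mem_hubs.1 (left_subset ((hmem c).1 hc).1 hu)).1⟩ (by simpa using hu)
        (by simpa using hu')
      rwa [Fin.mk.injEq, Nat.mod_eq_of_lt ((hg c hc).2.1 u), Nat.mod_eq_of_lt ((hg c' hc').2.1 u)]
        at h

end

/-! ### Components of the graph without the hub -/

/-- The lists `near I s w` are the components of the graph without the hub. -/
structure IsPartition (s : ℕ) (I : Inst) : Prop where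
  symm : ∀ u v, adj I u v = true → adj I v u = true
  refl : ∀ w ∈ outer I, w ∈ near I s w
  eq_of_mem : ∀ w ∈ outer I, ∀ u ∈ near I s w, near I s u = near I s w
  closed : ∀ w ∈ outer I, ∀ x ∈ near I s w, ∀ u ∈ outer I, adj I x u = true → u ∈ near I s w

section
variable {d s D : ℕ} {I : Inst} {f h : PA} {g : ℕ → ℕ}

theorem nodup_near (k w : ℕ) : (near I k w).Nodup := by
  cases k <;> exact nodup_outer.filter _

theorem mem_near_succ {k w u : ℕ} :
    u ∈ near I (k + 1) w ↔ u ∈ outer I ∧ ∃ x ∈ near I k w, x = u ∨ adj I x u = true := by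
  simp [near]

/-- All these lists inherit the order of `outer I`, so two of them with the same members are equal.
This allows components to be compared as lists. -/
theorem near_eq_filter (k w : ℕ) :
    near I k w = (outer I).filter fun u => decide (u ∈ near I k w) := by
  have key : ∀ p : ℕ → Bool, (outer I).filter p =
      (outer I).filter fun u => decide (u ∈ (outer I).filter p) := fun p =>
    List.filter_congr fun u hu => by
      rw [Bool.eq_iff_iff, decide_eq_true_eq, List.mem_filter]
      simp [hu]
  cases k <;> exact key _

namespace IsPartition

theorem near_mem_comps (hP : IsPartition s I) {w : ℕ} (hw : w ∈ outer I) :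
    near I s w ∈ comps s I := by
  have hne : near I s w ≠ [] := List.ne_nil_of_mem (hP.refl w hw)
  have hhd : (near I s w).headD 0 ∈ near I s w := by
    cases hl : near I s w with
    | nil => exact absurd hl hne
    | cons a l => simp
  have h := hP.eq_of_mem w hw _ hhd
  exact mem_comps.2 ⟨_, near_subset hhd, by rw [h], h⟩

theorem eq_of_mem_comps (hP : IsPartition s I) {C : List ℕ} {v : ℕ} (hC : C ∈ comps s I)
    (hv : v ∈ C) : C = near I s v := by
  obtain ⟨w, hw, -, rfl⟩ := mem_comps.1 hC
  exact (hP.eq_of_mem w hw v hv).symm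

/-- Each component is listed once, under its first vertex: near lists with a common member coincide
and have the same head. -/
theorem flatten_perm (hP : IsPartition s I) : (comps s I).flatten.Perm (outer I) := by
  refine (List.perm_ext_iff_of_nodup ?_ nodup_outer).2 fun v => ?_
  · rw [List.nodup_flatten]
    constructor
    · intro C hC
      obtain ⟨w, -, -, rfl⟩ := mem_comps.1 hC
      exact nodup_near _ _
    · unfold comps
      rw [List.pairwise_map]
      refine (List.Nodup.pairwise_of_forall_ne (nodup_outer.filter _) ?_)
      intro a ha b hb hab
      simp only [List.mem_filter, beq_iff_eq] at ha hb
      intro u hua hub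
      refine hab (ha.2.symm.trans (Eq.trans ?_ hb.2))
      rw [← hP.eq_of_mem a ha.1 u hua, ← hP.eq_of_mem b hb.1 u hub]
  · rw [List.mem_flatten]
    constructor
    · rintro ⟨C, hC, hv⟩
      obtain ⟨w, -, -, rfl⟩ := mem_comps.1 hC
      exact near_subset hv
    · exact fun hv => ⟨_, hP.near_mem_comps hv, hP.refl v hv⟩

/-- The components partition the outer vertices, and the constraints for pairs of hub vertices have
an empty second part. -/
theorem sum_right (hP : IsPartition s I) (F : ℕ → ℕ) :
    ((constraints s I).map fun c => (c.2.map F).sum).sum = ((outer I).map F).sum := by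
  rw [← (hP.flatten_perm.map F).sum_eq, constraints, List.map_append, List.sum_append, List.map_map,
    List.map_flatten, List.sum_flatten, List.map_map]
  have h : (((hubs I).flatMap fun u => (hubs I).map fun v => (([u, v], []) : Con)).map
      fun c => (c.2.map F).sum).sum = 0 := by
    refine List.sum_eq_zero fun k hk => ?_
    obtain ⟨c, hc, rfl⟩ := List.mem_map.1 hk
    obtain ⟨u, -, hc⟩ := List.mem_flatMap.1 hc
    obtain ⟨v, -, rfl⟩ := List.mem_map.1 hc
    rfl
  rw [h, add_zero]
  rfl

end IsPartition

theorem sum_hubs_add_outer (F : ℕ → ℕ) : ((hubs I).map F).sum + ((outer I).map F).sum =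
    ((verts I).map F).sum := by
  rw [← List.sum_append, ← List.map_append]
  refine ((List.Perm.map F ?_).sum_eq)
  exact List.filter_append_perm _ _

/-! ### From assignments of the hub to solutions -/

theorem assigned_best (hd : 0 < d) {c : Con} (hc : c.2.length ≤ s) {v : ℕ} :
    assigned (best d s I c f) v = true ↔ v ∈ c.2 := by
  rw [assigned_iff, (of_mem_assigns hc (best_spec hd hc).1).1]

/-- The best assignments do not interfere: none of them touches the hub, and a vertex outside of the
hub lies in a single component. -/
theorem col_completion (hd : 0 < d) (hI : Bounded s D I) (hP : IsPartition s I) {c : Con}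
    (hc : c ∈ constraints s I) {v : ℕ} (hv : v ∈ c.1 ++ c.2) :
    col (completion d s I f) v = col (best d s I c f ++ f) v := by
  rcases List.mem_append.1 hv with hv | hv
  · have hn : ∀ c' ∈ constraints s I, ¬assigned (best d s I c' f) v = true := fun c' hc' h =>
      not_mem_right hc' (left_subset hc hv) ((assigned_best hd (hI.right_length c' hc')).1 h)
    rw [completion, col_append, col_append, if_neg (hn c hc), if_neg]
    simp only [assigned, List.any_flatMap, List.any_eq_true]
    rintro ⟨c', hc', p, hp, hpv⟩
    exact hn c' hc' (List.any_eq_true.2 ⟨p, hp, hpv⟩)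
  · refine col_flatMap (fun c' hc' h => ?_)
      ⟨c, hc, (assigned_best hd (hI.right_length c hc)).2 hv⟩
    have hv' := (assigned_best hd (hI.right_length c' hc')).1 h
    obtain rfl : c' = c := by
      rcases mem_constraints.1 hc with ⟨C, hC, rfl⟩ | ⟨u, hu, w, hw, rfl⟩
      · rcases mem_constraints.1 hc' with ⟨C', hC', rfl⟩ | ⟨u, hu, w, hw, rfl⟩
        · rw [hP.eq_of_mem_comps hC hv, hP.eq_of_mem_comps hC' hv']
        · simp at hv'
      · simp at hv
    rw [col_append, if_pos h]

/-- The degenerate pairs `[v, v]` take care of the hub vertices, even isolated ones. -/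
theorem exists_constraint (hP : IsPartition s I) {v : ℕ} (hv : v < I.1.length) :
    ∃ c ∈ constraints s I, v ∈ c.1 ++ c.2 := by
  cases hb : bit I.2.2 v with
  | true =>
    have hv' := mem_hubs.2 ⟨hv, hb⟩
    exact ⟨([v, v], []), mem_constraints.2 (.inr ⟨v, hv', v, hv', rfl⟩), by simp⟩
  | false =>
    have hv' := mem_outer.2 ⟨hv, hb⟩
    exact ⟨_, mem_constraints.2 (.inl ⟨_, hP.near_mem_comps hv', rfl⟩),
      List.mem_append_right _ (hP.refl v hv')⟩

theorem mem_scope {C : List ℕ} {u : ℕ} :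
    u ∈ scope I C ↔ u ∈ hubs I ∧ ∃ x ∈ C, adj I x u = true := by
  simp [scope]

/-- An edge lies within the hub, within a component, or between a component and its `scope`. -/
theorem exists_constraint_of_adj (hP : IsPartition s I) {u v : ℕ} (hu : u < I.1.length)
    (hv : v < I.1.length) (huv : adj I u v = true) :
    ∃ c ∈ constraints s I, u ∈ c.1 ++ c.2 ∧ v ∈ c.1 ++ c.2 := by
  cases hbu : bit I.2.2 u with
  | true =>
    have hu' := mem_hubs.2 ⟨hu, hbu⟩
    cases hbv : bit I.2.2 v with
    | true =>
      have hv' := mem_hubs.2 ⟨hv, hbv⟩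
      exact ⟨([u, v], []), mem_constraints.2 (.inr ⟨u, hu', v, hv', rfl⟩), by simp, by simp⟩
    | false =>
      have hv' := mem_outer.2 ⟨hv, hbv⟩
      exact ⟨_, mem_constraints.2 (.inl ⟨_, hP.near_mem_comps hv', rfl⟩), List.mem_append_left _
        (mem_scope.2 ⟨hu', v, hP.refl v hv', hP.symm _ _ huv⟩),
        List.mem_append_right _ (hP.refl v hv')⟩
  | false =>
    have hu' := mem_outer.2 ⟨hu, hbu⟩
    refine ⟨_, mem_constraints.2 (.inl ⟨_, hP.near_mem_comps hu', rfl⟩),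
      List.mem_append_right _ (hP.refl u hu'), ?_⟩
    cases hbv : bit I.2.2 v with
    | true =>
      exact List.mem_append_left _ (mem_scope.2 ⟨mem_hubs.2 ⟨hv, hbv⟩, u, hP.refl u hu', huv⟩)
    | false =>
      exact List.mem_append_right _
        (hP.closed u hu' u (hP.refl u hu') v (mem_outer.2 ⟨hv, hbv⟩) huv)

/-- The violations at a vertex within a constraint. -/
def violations (I : Inst) (c : Con) (g : ℕ → ℕ) (v : ℕ) : ℕ :=
  (if allowed I v (g v) = true then 0 else 1) + ((c.1 ++ c.2).map fun u =>
    if (adj I u v && (g u == g v && !(g v == 0))) = true then 1 else 0).sum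

/-- A vertex that is deleted in spite of a nonzero color violates its list or shares its color with
a neighbor, and some constraint counts this violation. -/
theorem toDelete_le (hP : IsPartition s I) {v : ℕ} (hv : v < I.1.length) :
    (if toDelete I h v = true then 1 else 0) ≤ (if (col h v == 0) = true then 1 else 0) +
      ((constraints s I).map fun c =>
        if v ∈ c.1 ++ c.2 then violations I c (col h) v else 0).sum := by
  by_cases h0 : col h v = 0
  · simp only [h0, beq_self_eq_true, if_true]
    split <;> omega
  · by_cases hdel : toDelete I h v = true
    · have hex : ∃ c ∈ constraints s I, v ∈ c.1 ++ c.2 ∧ 1 ≤ violations I c (col h) v := by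
        rw [toDelete, beq_eq_false_iff_ne.2 h0, Bool.false_or, Bool.or_eq_true, List.any_eq_true]
          at hdel
        rcases hdel with hdel | ⟨u, hu, huv⟩
        · obtain ⟨c, hc, hvc⟩ := exists_constraint hP hv
          refine ⟨c, hc, hvc, ?_⟩
          rw [violations, if_neg (by simpa using hdel)]
          omega
        · rw [Bool.and_eq_true, beq_iff_eq] at huv
          rw [List.mem_range] at hu
          obtain ⟨c, hc, huc, hvc⟩ := exists_constraint_of_adj hP (hu.trans hv) hv huv.1
          refine ⟨c, hc, hvc, le_trans ?_ (Nat.le_add_left _ _)⟩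
          refine List.single_le_sum (by simp) _ (List.mem_map.2 ⟨u, huc, ?_⟩)
          simp [huv.1, huv.2, h0]
      obtain ⟨c, hc, hvc, h1⟩ := hex
      rw [if_pos hdel]
      refine le_trans h1 (le_trans ?_ (Nat.le_add_left _ _))
      exact List.single_le_sum (by simp) _ (List.mem_map.2 ⟨c, hc, by rw [if_pos hvc]⟩)
    · rw [if_neg hdel]
      exact Nat.zero_le _

/-- Equality may fail, for instance because `m` can have repetitions, as in the pair `[v, v]`. -/
theorem sum_ite_mem_le {l m : List ℕ} (hl : l.Nodup) (t : ℕ → ℕ) :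
    (l.map fun v => if v ∈ m then t v else 0).sum ≤ (m.map t).sum := by
  induction m with
  | nil => simp
  | cons a m ih =>
    have h1 : (l.map fun v => if v = a then t v else 0).sum ≤ t a := by
      clear ih
      induction l with
      | nil => simp
      | cons b l ih =>
        rw [List.nodup_cons] at hl
        rw [List.map_cons, List.sum_cons]
        by_cases hb : b = a
        · subst hb
          have : (l.map fun v => if v = b then t v else 0).sum = 0 := by
            refine List.sum_eq_zero fun k hk => ?_
            obtain ⟨v, hv, rfl⟩ := List.mem_map.1 hk
            rw [if_neg (by rintro rfl; exact hl.1 hv)]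
          simp [this]
        · rw [if_neg hb, zero_add]
          exact ih hl.2
    rw [List.map_cons, List.sum_cons]
    refine le_trans ?_ (Nat.add_le_add h1 ih)
    rw [← List.sum_map_add]
    refine List.sum_le_sum fun v _ => ?_
    by_cases hv : v = a <;> by_cases hm : v ∈ m <;> simp [hv, hm]

theorem sum_map_sum_comm {ι κ : Type*} (l : List ι) (m : List κ) (F : ι → κ → ℕ) :
    (l.map fun a => (m.map fun b => F a b).sum).sum =
      (m.map fun b => (l.map fun a => F a b).sum).sum := by
  induction l with
  | nil => simp
  | cons a l ih => simp only [List.map_cons, List.sum_cons, List.sum_map_add, ih]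

/-- Sum `toDelete_le` over all vertices and exchange the sums. The outer vertices of color 0 and the
violations make up the energies of the constraints, which are minimal because `best` colors the
components. Counting a violation in several constraints only weakens the upper bound. -/
theorem ones_solution_le (hd : 0 < d) (hI : Bounded s D I) (hP : IsPartition s I) (f : PA) :
    ones (solution d s I f) ≤ objective d s I (col f) := by
  set h := completion d s I f with hh
  have h1 : ones (solution d s I f) =
      ((verts I).map fun v => if toDelete I h v = true then 1 else 0).sum := by
    rw [ones, solution, List.map_map]
    rfl
  have h2 : ((verts I).map fun v => if toDelete I h v = true then 1 else 0).sum ≤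
      ((verts I).map fun v => if (col h v == 0) = true then 1 else 0).sum +
      ((constraints s I).map fun c => ((c.1 ++ c.2).map (violations I c (col h))).sum).sum := by
    refine le_trans (List.sum_le_sum fun v hv => toDelete_le hP (List.mem_range.1 hv)) ?_
    rw [List.sum_map_add, sum_map_sum_comm]
    exact Nat.add_le_add_left (List.sum_le_sum fun c _ => sum_ite_mem_le List.nodup_range _) _
  rw [← sum_hubs_add_outer fun v => if (col h v == 0) = true then 1 else 0, ← hP.sum_right fun v =>
    if (col h v == 0) = true then 1 else 0, add_assoc, ← List.sum_map_add] at h2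
  rw [h1]
  refine h2.trans (Nat.add_le_add (le_of_eq ?_) (List.sum_le_sum fun c hc => ?_))
  · congr 1
    refine List.map_congr_left fun v hv => ?_
    have hc : (([v, v], []) : Con) ∈ constraints s I :=
      mem_constraints.2 (.inr ⟨v, hv, v, hv, rfl⟩)
    have hn : ¬assigned (best d s I ([v, v], []) f) v = true := by
      rw [assigned_best hd (by simp)]
      simp
    rw [hh, col_completion hd hI hP hc (by simp), col_append, if_neg hn]
    simp
  · rw [← cost_eq hd (hI.right_length c hc), cost]
    rw [← energy_congr (c := c) (g := col h) fun v hv => col_completion hd hI hP hc hv]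
    exact le_rfl

end

/-! ### The encoding of an instance -/

theorem bit_ofFn {n : ℕ} {b : Fin n → Bool} {i : ℕ} :
    bit (List.ofFn b) i = true ↔ ∃ h : i < n, b ⟨i, h⟩ = true := by
  rw [bit, List.headD_eq_head?_getD, List.head?_drop]
  by_cases h : i < n
  · simp [h]
  · simp [h]

section
variable {n q : ℕ} (G : SimpleGraph (Fin n)) (L : Fin n → Finset (Fin q)) (Q : Finset (Fin n))

open Classical in
/-- The instance, as a tuple of lists. -/
noncomputable def toInst : Inst :=
  (List.ofFn fun u => List.ofFn fun v => decide (G.Adj u v),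
    List.ofFn fun v => List.ofFn fun i => decide (i ∈ L v), List.ofFn fun v => decide (v ∈ Q))

theorem enc_ofFn {α : Type} [Enc α] (b : Fin n → α) :
    Enc.enc (List.ofFn b) = Val.ofList (List.ofFn fun i => Enc.enc (b i)) := by
  change Val.ofList _ = _
  rw [List.map_ofFn]
  rfl

theorem enc_toInst : Enc.enc (toInst G L Q) = encodeInput G L Q := by
  have hb : ∀ {m : ℕ} (b : Fin m → Bool), Enc.enc (List.ofFn b) = Val.ofBits b := fun b =>
    enc_ofFn b
  change Val.cons (Enc.enc (List.ofFn _))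
    (.cons (Enc.enc (List.ofFn _)) (Enc.enc (List.ofFn _))) = _
  rw [enc_ofFn, enc_ofFn, hb]
  simp only [hb]
  rfl

@[simp] theorem length_toInst : (toInst G L Q).1.length = n := by
  simp [toInst]

variable {G L Q}

theorem adj_toInst {u v : ℕ} : adj (toInst G L Q) u v = true ↔
    ∃ (hu : u < n) (hv : v < n), G.Adj ⟨u, hu⟩ ⟨v, hv⟩ := by
  rw [adj, List.headD_eq_head?_getD, List.head?_drop]
  by_cases hu : u < n
  · simp only [toInst, List.getElem?_ofFn, hu, dif_pos, Option.getD_some, bit_ofFn]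
    simp
  · simp [toInst, hu, bit]

theorem allowed_toInst {v a : ℕ} : allowed (toInst G L Q) v (a + 1) = true ↔
    ∃ (hv : v < n) (ha : a < q), (⟨a, ha⟩ : Fin q) ∈ L ⟨v, hv⟩ := by
  rw [allowed, List.headD_eq_head?_getD, List.head?_drop]
  change bit _ a = true ↔ _
  by_cases hv : v < n
  · simp only [toInst, List.getElem?_ofFn, hv, dif_pos, Option.getD_some, bit_ofFn]
    simp
  · simp [toInst, hv, bit]

theorem mem_hubs_toInst {v : ℕ} :
    v ∈ hubs (toInst G L Q) ↔ ∃ hv : v < n, (⟨v, hv⟩ : Fin n) ∈ Q := by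
  rw [mem_hubs, length_toInst]
  simp only [toInst, bit_ofFn, decide_eq_true_eq]
  exact ⟨fun h => h.2, fun h => ⟨h.1, h⟩⟩

theorem mem_outer_toInst {v : ℕ} :
    v ∈ outer (toInst G L Q) ↔ ∃ hv : v < n, (⟨v, hv⟩ : Fin n) ∉ Q := by
  rw [mem_outer, length_toInst, ← Bool.not_eq_true]
  simp only [toInst, bit_ofFn, decide_eq_true_eq]
  constructor
  · exact fun h => ⟨h.1, fun h' => h.2 ⟨h.1, h'⟩⟩
  · exact fun ⟨h1, h2⟩ => ⟨h1, fun h => h2 h.2⟩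

/-! ### Near lists and connected components -/

theorem near_of_walk {w k : ℕ} {x y : {v : Fin n | v ∉ Q}}
    (p : (G.induce {v : Fin n | v ∉ Q}).Walk x y) (hx : x.1.1 ∈ near (toInst G L Q) k w) :
    y.1.1 ∈ near (toInst G L Q) (k + p.length) w := by
  induction p generalizing k with
  | nil => exact hx
  | cons hadj p ih =>
    rename_i a b c
    rw [SimpleGraph.Walk.length_cons, add_comm p.length, ← add_assoc]
    exact ih (mem_near_succ.2 ⟨mem_outer_toInst.2 ⟨b.1.2, b.2⟩, a.1.1, hx,
      .inr (adj_toInst.2 ⟨a.1.2, b.1.2, hadj⟩)⟩)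

theorem near_mono {I : Inst} {k k' w u : ℕ} (h : k ≤ k') (hu : u ∈ near I k w) :
    u ∈ near I k' w := by
  induction h with
  | refl => exact hu
  | step _ ih => exact mem_near_succ.2 ⟨near_subset ih, u, ih, .inl rfl⟩

theorem reachable_of_near {k u : ℕ} {w : {v : Fin n | v ∉ Q}}
    (hu : u ∈ near (toInst G L Q) k w.1.1) : ∃ y : {v : Fin n | v ∉ Q}, y.1.1 = u ∧
      (G.induce {v : Fin n | v ∉ Q}).Reachable w y := by
  induction k generalizing u with
  | zero =>
    obtain rfl : u = w.1.1 := by simpa using (List.mem_filter.1 hu).2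
    exact ⟨w, rfl, .rfl⟩
  | succ k ih =>
    obtain ⟨h1, x, hx, h2⟩ := mem_near_succ.1 hu
    obtain ⟨y, rfl, hy⟩ := ih hx
    rcases h2 with rfl | h2
    · exact ⟨y, rfl, hy⟩
    · obtain ⟨hu1, hu2⟩ := mem_outer_toInst.1 h1
      obtain ⟨_, _, h3⟩ := adj_toInst.1 h2
      exact ⟨⟨⟨u, hu1⟩, hu2⟩, rfl, hy.trans (SimpleGraph.Adj.reachable h3)⟩

variable {σ δ : ℕ}

/-- A path outside of the hub stays in one component, which has at most `σ` vertices; its length is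
therefore below `σ`, and `σ` rounds of `near` reach its end. -/
theorem mem_near_iff (hQ : IsHub G σ δ Q) {w y : {v : Fin n | v ∉ Q}} :
    y.1.1 ∈ near (toInst G L Q) σ w.1.1 ↔ (G.induce {v : Fin n | v ∉ Q}).Reachable w y := by
  classical
  constructor
  · intro h
    obtain ⟨z, hz, hr⟩ := reachable_of_near h
    obtain rfl : z = y := Subtype.ext (Fin.ext hz)
    exact hr
  · intro h
    obtain ⟨p, hp⟩ := h.exists_isPath
    have h0 : w.1.1 ∈ near (toInst G L Q) 0 w.1.1 :=
      List.mem_filter.2 ⟨mem_outer_toInst.2 ⟨w.1.2, w.2⟩, by simp⟩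
    refine near_mono ?_ (near_of_walk p h0)
    have h1 : ((p.support.toFinset : Finset _) : Set {v : Fin n | v ∉ Q}) ⊆
        ((G.induce {v : Fin n | v ∉ Q}).connectedComponentMk w).supp := by
      intro z hz
      rw [List.coe_toFinset, Set.mem_ofPred_eq] at hz
      exact SimpleGraph.ConnectedComponent.sound (p.takeUntil z hz).reachable.symm
    have h2 := (Set.encard_le_encard h1).trans (hQ _).1
    rw [Set.encard_coe_eq_coe_finsetCard, List.toFinset_card_of_nodup hp.support_nodup,
      SimpleGraph.Walk.length_support] at h2
    have : p.length + 1 ≤ σ := by exact_mod_cast h2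
    omega

theorem isPartition_toInst (hQ : IsHub G σ δ Q) : IsPartition σ (toInst G L Q) := by
  refine ⟨fun u v h => ?_, fun w hw => ?_, fun w hw u hu => ?_, fun w hw x hx u hu hxu => ?_⟩
  · obtain ⟨hu, hv, h⟩ := adj_toInst.1 h
    exact adj_toInst.2 ⟨hv, hu, h.symm⟩
  · obtain ⟨h1, h2⟩ := mem_outer_toInst.1 hw
    exact (mem_near_iff hQ (w := ⟨⟨w, h1⟩, h2⟩) (y := ⟨⟨w, h1⟩, h2⟩)).2 .rfl
  · obtain ⟨h1, h2⟩ := mem_outer_toInst.1 hw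
    obtain ⟨h3, h4⟩ := mem_outer_toInst.1 (near_subset hu)
    have h5 := (mem_near_iff hQ (w := ⟨⟨w, h1⟩, h2⟩) (y := ⟨⟨u, h3⟩, h4⟩)).1 hu
    rw [near_eq_filter, near_eq_filter σ w]
    refine List.filter_congr fun v hv => ?_
    obtain ⟨h6, h7⟩ := mem_outer_toInst.1 hv
    rw [Bool.eq_iff_iff, decide_eq_true_eq, decide_eq_true_eq]
    refine (mem_near_iff hQ (w := ⟨⟨u, h3⟩, h4⟩) (y := ⟨⟨v, h6⟩, h7⟩)).trans (Iff.trans ?_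
      (mem_near_iff hQ (w := ⟨⟨w, h1⟩, h2⟩) (y := ⟨⟨v, h6⟩, h7⟩)).symm)
    exact ⟨h5.trans, h5.symm.trans⟩
  · obtain ⟨h1, h2⟩ := mem_outer_toInst.1 hw
    obtain ⟨h3, h4⟩ := mem_outer_toInst.1 (near_subset hx)
    obtain ⟨h5, h6⟩ := mem_outer_toInst.1 hu
    have h7 := (mem_near_iff hQ (w := ⟨⟨w, h1⟩, h2⟩) (y := ⟨⟨x, h3⟩, h4⟩)).1 hx
    obtain ⟨_, _, h8⟩ := adj_toInst.1 hxu
    refine (mem_near_iff hQ (w := ⟨⟨w, h1⟩, h2⟩) (y := ⟨⟨u, h5⟩, h6⟩)).2 (h7.trans ?_)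
    exact SimpleGraph.Adj.reachable (G := G.induce {v : Fin n | v ∉ Q}) (u := ⟨⟨x, h3⟩, h4⟩)
      (v := ⟨⟨u, h5⟩, h6⟩) h8

theorem length_le_of_encard {l : List ℕ} (hl : l.Nodup) {α : Type*} {S : Set α} {F : α → ℕ} {k : ℕ}
    (hS : S.encard ≤ k) (h : ∀ v ∈ l, ∃ y ∈ S, F y = v) : l.length ≤ k := by
  have h1 : ((l.toFinset : Finset ℕ) : Set ℕ) ⊆ F '' S := by
    intro v hv
    simpa using h v (by simpa using hv)
  have h2 := ((Set.encard_le_encard h1).trans (Set.encard_image_le F S)).trans hS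
  rw [Set.encard_coe_eq_coe_finsetCard, List.toFinset_card_of_nodup hl] at h2
  exact_mod_cast h2

/-- The 2 in `max δ 2` accounts for the pairs of hub vertices. -/
theorem bounded_toInst (hQ : IsHub G σ δ Q) : Bounded σ (max δ 2) (toInst G L Q) := by
  have key : ∀ C ∈ comps σ (toInst G L Q), C.length ≤ σ ∧ (scope (toInst G L Q) C).length ≤ δ := by
    intro C hC
    obtain ⟨w, hw, -, rfl⟩ := mem_comps.1 hC
    obtain ⟨h1, h2⟩ := mem_outer_toInst.1 hw
    have hmem : ∀ v ∈ near (toInst G L Q) σ w, ∃ y ∈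
        ((G.induce {v : Fin n | v ∉ Q}).connectedComponentMk
        ⟨⟨w, h1⟩, h2⟩).supp, y.1.1 = v := by
      intro v hv
      obtain ⟨y, hy, hr⟩ := reachable_of_near (w := ⟨⟨w, h1⟩, h2⟩) hv
      exact ⟨y, SimpleGraph.ConnectedComponent.sound hr.symm, hy⟩
    obtain ⟨h3, h4⟩ := hQ ((G.induce {v : Fin n | v ∉ Q}).connectedComponentMk ⟨⟨w, h1⟩, h2⟩)
    refine ⟨length_le_of_encard (nodup_near _ _) h3 hmem,
      length_le_of_encard (F := Fin.val) (nodup_hubs.filter _) h4 fun u hu => ?_⟩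
    obtain ⟨hu1, x, hx, hxu⟩ := mem_scope.1 hu
    obtain ⟨hu2, hu3⟩ := mem_hubs_toInst.1 hu1
    obtain ⟨y, hy, rfl⟩ := hmem x hx
    obtain ⟨_, _, h5⟩ := adj_toInst.1 hxu
    exact ⟨⟨u, hu2⟩, ⟨hu3, y, hy, h5.symm⟩, rfl⟩
  constructor
  · intro c hc
    rcases mem_constraints.1 hc with ⟨C, hC, rfl⟩ | ⟨u, hu, v, hv, rfl⟩
    · exact (key C hC).2.trans (le_max_left _ _)
    · exact le_max_right _ _
  · intro c hc
    rcases mem_constraints.1 hc with ⟨C, hC, rfl⟩ | ⟨u, hu, v, hv, rfl⟩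
    · exact (key C hC).1
    · exact Nat.zero_le _

theorem sum_verts (F : ℕ → ℕ) :
    ((verts (toInst G L Q)).map F).sum = ∑ v : Fin n, F v := by
  rw [← Finset.sum_range, verts, length_toInst]
  rfl

/-- Every deletion set gives an assignment of the hub. -/
theorem exists_objective_le (hQ : IsHub G σ δ Q) {Y : Finset (Fin n)} (hY : IsDeletionSet G L Y) :
    ∃ g : ℕ → ℕ, (∀ v, g v < q + 1) ∧ objective (q + 1) σ (toInst G L Q) g ≤ Y.card := by
  classical
  obtain ⟨φ, hφ⟩ := hY
  -- Deleted vertices, and numbers that are not vertices, get color 0; the others keep their color,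
  -- shifted by one.
  set g : ℕ → ℕ := fun v => if h : ∃ hv : v < n, (⟨v, hv⟩ : Fin n) ∉ Y then
    (φ ⟨⟨v, h.1⟩, h.2⟩ : ℕ) + 1 else 0 with hg
  have hpos : ∀ v, g v ≠ 0 → ∃ (hv : v < n) (hvY : (⟨v, hv⟩ : Fin n) ∉ Y),
      g v = (φ ⟨⟨v, hv⟩, hvY⟩ : ℕ) + 1 := by
    intro v hv
    by_cases h : ∃ hv : v < n, (⟨v, hv⟩ : Fin n) ∉ Y
    · exact ⟨h.1, h.2, by rw [hg]; simp only [dif_pos h]⟩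
    · exact absurd (by rw [hg]; simp only [dif_neg h]) hv
  have hlt : ∀ v, g v < q + 1 := by
    intro v
    by_cases h : g v = 0
    · omega
    · obtain ⟨hv, hvY, h⟩ := hpos v h
      have := (φ ⟨⟨v, hv⟩, hvY⟩).2
      omega
  refine ⟨g, hlt, ?_⟩
  -- The coloring `g` is one of its own recolorings and violates nothing, so only deletions in the
  -- second part are charged.
  have henergy : ∀ c : Con, minEnergy (q + 1) (toInst G L Q) c g ≤
      (c.2.map fun v => if g v = 0 then 1 else 0).sum := by
    intro c
    refine (minEnergy_le ⟨fun _ _ => rfl, fun v _ => hlt v⟩).trans ?_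
    rw [energy]
    have h0 : ((c.1 ++ c.2).map fun v => (if allowed (toInst G L Q) v (g v) = true then 0 else 1) +
        ((c.1 ++ c.2).map fun u => if (adj (toInst G L Q) u v && (g u == g v && !(g v == 0))) = true
          then 1 else 0).sum).sum = 0 := by
      refine List.sum_eq_zero fun k hk => ?_
      obtain ⟨v, -, rfl⟩ := List.mem_map.1 hk
      by_cases hv0 : g v = 0
      · simp [hv0, allowed_zero]
      · obtain ⟨hv, hvY, hgv⟩ := hpos v hv0
        have hall : allowed (toInst G L Q) v (g v) = true := by
          rw [hgv, allowed_toInst]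
          exact ⟨hv, (φ _).2, hφ ⟨⟨v, hv⟩, hvY⟩⟩
        rw [if_pos hall, zero_add]
        refine List.sum_eq_zero fun k hk => ?_
        obtain ⟨u, -, rfl⟩ := List.mem_map.1 hk
        rw [if_neg]
        intro hcon
        simp only [Bool.and_eq_true, beq_iff_eq] at hcon
        obtain ⟨hadj, heq, -⟩ := hcon
        obtain ⟨hu, huY, hgu⟩ := hpos u (heq ▸ hv0)
        obtain ⟨_, _, hadj⟩ := adj_toInst.1 hadj
        have hne := φ.valid (v := ⟨⟨u, hu⟩, huY⟩) (w := ⟨⟨v, hv⟩, hvY⟩) hadj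
        exact hne (Fin.ext (by omega))
    rw [h0, add_zero]
    simp
  have hsum := (isPartition_toInst (L := L) hQ).sum_right fun v => if g v = 0 then 1 else 0
  calc objective (q + 1) σ (toInst G L Q) g
      ≤ ((hubs (toInst G L Q)).map fun v => if g v = 0 then 1 else 0).sum +
        ((constraints σ (toInst G L Q)).map fun c =>
          (c.2.map fun v => if g v = 0 then 1 else 0).sum).sum :=
        Nat.add_le_add_left (List.sum_le_sum fun c _ => henergy c) _
    _ = ∑ v : Fin n, if g v = 0 then 1 else 0 := by rw [hsum, sum_hubs_add_outer, sum_verts]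
    _ = Y.card := by
      rw [← Finset.sum_filter, Finset.sum_const, smul_eq_mul, mul_one]
      congr 1
      ext v
      simp only [Finset.mem_filter, Finset.mem_univ, true_and]
      constructor
      · intro h
        by_contra hvY
        have h' : ∃ hv : v.1 < n, (⟨v.1, hv⟩ : Fin n) ∉ Y := ⟨v.2, hvY⟩
        rw [hg] at h
        simp only [dif_pos h'] at h
        omega
      · intro h
        rw [hg]
        simp only
        rw [dif_neg]
        rintro ⟨hv, h'⟩
        exact h' h

/-- Of an edge whose ends have the same nonzero color, the larger end is deleted. Hence every
assignment, optimal or not, yields a valid deletion set. -/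
theorem isDeletionSet_toDelete (h : PA) : IsDeletionSet G L
    (Finset.univ.filter fun v : Fin n => toDelete (toInst G L Q) h v = true) := by
  have key : ∀ v : {v : Fin n | v ∉ Finset.univ.filter fun v : Fin n =>
      toDelete (toInst G L Q) h v = true}, ∃ a : Fin q, a ∈ L v.1 ∧ col h v.1 = a + 1 ∧
        ∀ u < v.1.1, adj (toInst G L Q) u v.1 = true → col h u ≠ col h v.1 := by
    rintro ⟨v, hv⟩
    simp only [toDelete, Set.mem_ofPred_eq, Finset.mem_filter, Finset.mem_univ, true_and,
      Bool.or_eq_true, not_or, beq_iff_eq, Bool.not_eq_true', Bool.not_eq_false, List.any_eq_true,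
      List.mem_range, Bool.and_eq_true, not_exists, not_and] at hv
    obtain ⟨h1, h2, h3⟩ := hv
    obtain ⟨a, ha⟩ := Nat.exists_eq_succ_of_ne_zero h1
    rw [ha, Nat.succ_eq_add_one, allowed_toInst] at h2
    obtain ⟨_, ha', haL⟩ := h2
    exact ⟨⟨a, ha'⟩, haL, ha, h3⟩
  choose φ hφL hφ hφ' using key
  refine ⟨SimpleGraph.Coloring.mk φ fun {x y} hxy heq => ?_, hφL⟩
  have hxy' : G.Adj x.1 y.1 := hxy
  have hc : col h x.1 = col h y.1 := by rw [hφ, hφ, heq]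
  rcases lt_trichotomy x.1.1 y.1.1 with hlt | hE | hlt
  · exact hφ' y _ hlt (adj_toInst.2 ⟨x.1.2, y.1.2, hxy'⟩) hc
  · exact hxy'.ne (Fin.ext hE)
  · exact hφ' x _ hlt (adj_toInst.2 ⟨y.1.2, x.1.2, hxy'.symm⟩) hc.symm

end

/-! ### The search -/

/-- A partial assignment of the hub. -/
def IsPartial (d : ℕ) (I : Inst) (f : PA) : Prop :=
  (∀ p ∈ f, p.1 ∈ hubs I ∧ p.2 < d) ∧ (f.map Prod.fst).Nodup

section
variable {d s D K W p : ℕ} {I : Inst} {f τ : PA} {g : ℕ → ℕ} {v x : ℕ}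

theorem mem_children {f' : PA} : f' ∈ children d K f τ ↔
    ∃ τ' ∈ assigns d K (τ.map Prod.fst), (∃ y ∈ τ, col τ' y.1 ≠ y.2) ∧ τ' ++ f = f' := by
  simp only [children, List.mem_map, List.mem_filter, List.any_eq_true, Bool.not_eq_true',
    beq_eq_false_iff_ne, and_assoc]

/-- What is known about the assignment that is pruned. -/
structure Prunes (d s D K : ℕ) (I : Inst) (f τ : PA) (v x : ℕ) : Prop where
  length_le : (τ.map Prod.fst).length ≤ K
  nodup : (τ.map Prod.fst).Nodup
  free : ∀ u ∈ τ.map Prod.fst, u ∈ free I f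
  mem : τ ∈ assigns d K (τ.map Prod.fst)
  mem_fst : v ∈ τ.map Prod.fst
  lt : x < d
  ne : col τ v ≠ x
  dominated : dominated d s D I (τ ++ f) v x = true

theorem prunes_of_mem (h : (τ, v, x) ∈ prunable d s D K I f) : Prunes d s D K I f τ v x := by
  simp only [prunable, changes, List.mem_filter, List.mem_flatMap, List.mem_map, List.mem_range,
    Bool.and_eq_true, Bool.not_eq_true', beq_eq_false_iff_ne, Prod.mk.injEq] at h
  obtain ⟨⟨S, hS, τ', hτ', v', hv', x', hx', rfl, rfl, rfl⟩, hne, hdom⟩ := h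
  rw [mem_tuples] at hS
  obtain ⟨h1, h2, h3⟩ := hS
  have h4 := (of_mem_assigns h1 hτ').1
  refine ⟨?_, ?_, ?_, ?_, ?_, hx', hne, hdom⟩ <;> rw [h4] <;> assumption

namespace Prunes

theorem pos (h : Prunes d s D K I f τ v x) : 0 < (τ.map Prod.fst).length :=
  List.length_pos_of_mem h.mem_fst

theorem col_eq (h : Prunes d s D K I f τ v x) {y : ℕ × ℕ} (hy : y ∈ τ) : col τ y.1 = y.2 := by
  rw [eq_map_col h.nodup] at hy
  obtain ⟨u, -, rfl⟩ := List.mem_map.1 hy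
  rfl

/-- `τ` is a member of `assigns` and is filtered out; this one missing child is the entire gain over
brute force. -/
theorem length_children (h : Prunes d s D K I f τ v x) :
    (children d K f τ).length + 1 ≤ d ^ (τ.map Prod.fst).length := by
  rw [← length_assigns h.length_le, children, List.length_map, Nat.add_one_le_iff,
    List.length_filter_lt_length_iff_exists]
  refine ⟨τ, h.mem, ?_⟩
  simp only [List.any_eq_true, Bool.not_eq_true', beq_eq_false_iff_ne, not_exists, not_and, not_not]
  exact fun y hy => h.col_eq hy

theorem length_free (h : Prunes d s D K I f τ v x) {f' : PA} (hf' : f' ∈ children d K f τ) :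
    (HubColoring.free I f').length + (τ.map Prod.fst).length ≤ (HubColoring.free I f).length := by
  obtain ⟨τ', hτ', -, rfl⟩ := mem_children.1 hf'
  have h1 := (of_mem_assigns h.length_le hτ').1
  rw [← List.length_append]
  have hmem : ∀ u, u ∈ HubColoring.free I (τ' ++ f) ↔
      u ∈ HubColoring.free I f ∧ u ∉ τ.map Prod.fst := by
    intro u
    rw [mem_free, mem_free, assigned_append, Bool.or_eq_false_iff, ← Bool.not_eq_true,
      assigned_iff, h1]
    tauto
  refine (List.subperm_of_subset (List.nodup_append.2 ⟨nodup_hubs.filter _, h.nodup, ?_⟩)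
    fun u hu => ?_).length_le
  · rintro a ha b hb rfl
    exact ((hmem a).1 ha).2 hb
  · exact (List.mem_append.1 hu).elim (fun hu => ((hmem u).1 hu).1) (h.free u)

theorem isPartial (h : Prunes d s D K I f τ v x) (hf : IsPartial d I f) {f' : PA}
    (hf' : f' ∈ children d K f τ) : IsPartial d I f' := by
  obtain ⟨τ', hτ', -, rfl⟩ := mem_children.1 hf'
  obtain ⟨h1, h2⟩ := of_mem_assigns h.length_le hτ'
  constructor
  · intro y hy
    rcases List.mem_append.1 hy with hy | hy
    · refine ⟨(mem_free.1 (h.free _ ?_)).1, h2 y hy⟩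
      rw [← h1]
      exact List.mem_map_of_mem hy
    · exact hf.1 y hy
  · rw [List.map_append, h1]
    refine List.nodup_append.2 ⟨h.nodup, hf.2, ?_⟩
    rintro a ha b hb rfl
    have := (mem_free.1 (h.free a ha)).2
    rw [assigned_iff.2 hb] at this
    exact absurd this (by simp)

/-- Pruning keeps an assignment that is at least as good. -/
theorem exists_child (h : Prunes d s D K I f τ v x) (hd : 0 < d) (hI : Bounded s D I)
    (hg : ∀ u, g u < d) (hfg : ∀ u, assigned f u = true → g u = col f u) :
    ∃ f' ∈ children d K f τ, ∃ g' : ℕ → ℕ, (∀ u, g' u < d) ∧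
      (∀ u, assigned f' u = true → g' u = col f' u) ∧
      objective d s I g' ≤ objective d s I g := by
  have key : ∀ g' : ℕ → ℕ, (∀ u, g' u < d) → (∀ u, assigned f u = true → g' u = col f u) →
      (∃ y ∈ τ, g' y.1 ≠ y.2) → ∃ f' ∈ children d K f τ,
        ∀ u, assigned f' u = true → g' u = col f' u := by
    rintro g' hg' hfg' ⟨y, hy, hne⟩
    refine ⟨_, mem_children.2 ⟨_, map_mem_assigns (g := g') h.length_le fun u _ => hg' u,
      ⟨y, hy, ?_⟩, rfl⟩, fun u hu => ?_⟩
    · rwa [col_map (List.mem_map_of_mem hy)]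
    · rw [col_append]
      rw [assigned_append, Bool.or_eq_true] at hu
      split
      · rename_i hu'
        rw [assigned_map, decide_eq_true_eq] at hu'
        rw [col_map hu']
      · rename_i hu'
        exact hfg' u (hu.resolve_left hu')
  -- Either `g` differs from `τ` and extends a child already, or it extends `τ`, and then giving `v`
  -- the color `x` leads away from `τ` without loss.
  by_cases hτ : ∃ y ∈ τ, g y.1 ≠ y.2
  · obtain ⟨f', hf', h'⟩ := key g hg hfg hτ
    exact ⟨f', hf', g, hg, h', le_rfl⟩
  · push Not at hτ
    have hfv := mem_free.1 (h.free v h.mem_fst)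
    obtain ⟨f', hf', h'⟩ := key (Function.update g v x)
      (fun u => by
        rw [Function.update_apply]
        split
        exacts [h.lt, hg u])
      (fun u hu => by
        rw [Function.update_of_ne, hfg u hu]
        rintro rfl
        rw [hfv.2] at hu
        exact absurd hu (by simp))
      (by
        obtain ⟨y, hy, rfl⟩ := List.mem_map.1 h.mem_fst
        refine ⟨y, hy, ?_⟩
        rw [Function.update_self, ← h.col_eq hy]
        exact h.ne.symm)
    refine ⟨f', hf', _, fun u => ?_, h', objective_update_le hd hI h.dominated hfv.1 ?_ hg ?_⟩
    · rw [Function.update_apply]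
      split
      exacts [h.lt, hg u]
    · rw [assigned_append, assigned_iff.2 h.mem_fst, Bool.true_or]
    · intro u hu
      rw [col_append]
      rw [assigned_append, Bool.or_eq_true] at hu
      split
      · rename_i hu'
        obtain ⟨y, hy, rfl⟩ := List.mem_map.1 (assigned_iff.1 hu')
        rw [hτ y hy, h.col_eq hy]
      · rename_i hu'
        exact hfg u (hu.resolve_left hu')

end Prunes

theorem objective_congr (hd : 0 < d) {g g' : ℕ → ℕ} (h : ∀ u ∈ hubs I, g u = g' u) :
    objective d s I g = objective d s I g' := by
  unfold objective
  congr 2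
  · exact List.map_congr_left fun u hu => by rw [h u hu]
  · exact List.map_congr_left fun c hc => minEnergy_congr hd fun u hu => h u (left_subset hc hu)

/-- The bound for the length of the stack. -/
def StackBound (W p : ℕ) (I : Inst) : List PA → Prop
  | [] => True
  | f :: l => l.length + W * (free I f).length ≤ W * p ∧ StackBound W p I l

theorem StackBound.length_le {l : List PA} (h : StackBound W p I l) : l.length ≤ W * p + 1 := by
  cases l with
  | nil => simp
  | cons f l =>
    have := h.1
    rw [List.length_cons]
    omega

/-- Here `u` is the number of free vertices of the assignment that was replaced. Each of the at most
`W` new ones has fewer free vertices, which makes room for `W` more entries below it. -/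
theorem StackBound.append {l l' : List PA} {u : ℕ} (h : StackBound W p I l)
    (hu : l.length + W * u ≤ W * p) (hl : l'.length ≤ W)
    (h' : ∀ f ∈ l', (free I f).length + 1 ≤ u) : StackBound W p I (l' ++ l) := by
  induction l' with
  | nil => exact h
  | cons f l' ih =>
    rw [List.length_cons] at hl
    refine ⟨?_, ih (by omega) fun f hf => h' f (List.mem_cons_of_mem _ hf)⟩
    have h1 := Nat.mul_le_mul_left W (h' f List.mem_cons_self)
    rw [mul_add, mul_one] at h1
    have h2 : (l' ++ l).length = l'.length + l.length := List.length_append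
    change (l' ++ l).length + W * ((free I f).length) ≤ W * p
    rw [h2]
    omega

/-- The potential of a stack. -/
noncomputable def potential (r : ℝ) (I : Inst) (l : List PA) : ℝ :=
  (l.map fun f => 2 * r ^ (free I f).length - 1).sum

theorem potential_nonneg {r : ℝ} (hr : 1 ≤ r) (l : List PA) : 0 ≤ potential r I l := by
  refine List.sum_nonneg fun a ha => ?_
  obtain ⟨f, -, rfl⟩ := List.mem_map.1 ha
  have := one_le_pow₀ (n := (free I f).length) hr
  linarith

/-- With `u` free vertices, `k` of which get assigned, the children contribute at most `(d ^ k - 1)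
* (2 * r ^ (u - k) - 1) ≤ 2 * r ^ u - (d ^ k - 1)`. As `d ^ k - 1 ≥ 2`, this leaves a drop of one;
the summand `-1` in the potential thus pays for the branching step itself. -/
theorem Prunes.potential_children (h : Prunes d s D K I f τ v x) {r : ℝ} (hr : 1 ≤ r) (hd : 3 ≤ d)
    (hK : ∀ k, 1 ≤ k → k ≤ K → (d : ℝ) ^ k - 1 ≤ r ^ k) :
    potential r I (children d K f τ) + 1 ≤ 2 * r ^ (HubColoring.free I f).length - 1 := by
  set k := (τ.map Prod.fst).length with hk
  set u := (HubColoring.free I f).length with hu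
  have hk0 : 1 ≤ k := h.pos
  have hku : k ≤ u := (List.subperm_of_subset h.nodup fun u hu => h.free u hu).length_le
  have h1 : potential r I (children d K f τ) ≤
      ((children d K f τ).length : ℝ) * (2 * r ^ (u - k) - 1) := by
    have := List.sum_le_card_nsmul ((children d K f τ).map fun f' =>
      2 * r ^ (HubColoring.free I f').length - 1) (2 * r ^ (u - k) - 1) (by
        intro a ha
        obtain ⟨f', hf', rfl⟩ := List.mem_map.1 ha
        have := h.length_free hf'
        have := pow_le_pow_right₀ hr (show (HubColoring.free I f').length ≤ u - k by omega)
        linarith)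
    simpa [potential] using this
  have h2 : ((children d K f τ).length : ℝ) ≤ (d : ℝ) ^ k - 1 := by
    have := h.length_children
    have h3 : (((children d K f τ).length + 1 : ℕ) : ℝ) ≤ ((d ^ k : ℕ) : ℝ) := by
      exact_mod_cast this
    push_cast at h3
    linarith
  have h3 := one_le_pow₀ (n := u - k) hr
  have h4 : r ^ k * r ^ (u - k) = r ^ u := by rw [← pow_add, Nat.add_sub_cancel' hku]
  have h5 : (3 : ℝ) ≤ (d : ℝ) ^ k := by
    have hd' : (3 : ℝ) ≤ d := by exact_mod_cast hd
    exact hd'.trans (le_self_pow₀ (by linarith) (by omega))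
  have h6 := mul_le_mul_of_nonneg_right h2 (show (0 : ℝ) ≤ 2 * r ^ (u - k) - 1 by linarith)
  have h7 := mul_le_mul_of_nonneg_right (hK k hk0 h.length_le)
    (show (0 : ℝ) ≤ r ^ (u - k) by linarith)
  rw [h4] at h7
  nlinarith

end

/-! ### The invariant of the search -/

section
variable {n q σ δ : ℕ} {G : SimpleGraph (Fin n)} {L : Fin n → Finset (Fin q)} {Q : Finset (Fin n)}

/-- The characteristic vector of a set, as a list. -/
def bits (X : Finset (Fin n)) : List Bool := List.ofFn fun v => decide (v ∈ X)

theorem enc_bits (X : Finset (Fin n)) : Enc.enc (bits X) = encodeSet X := enc_ofFn _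

theorem ones_bits (X : Finset (Fin n)) : ones (bits X) = X.card := by
  rw [ones, bits, List.map_ofFn, List.sum_ofFn]
  simp

theorem map_verts (F : ℕ → Bool) :
    (verts (toInst G L Q)).map F = bits (Finset.univ.filter fun v : Fin n => F v = true) := by
  rw [verts, length_toInst, bits]
  refine List.ext_getElem (by simp) fun i h1 h2 => ?_
  simp

/-- The invariant of the search. -/
structure SearchInv (σ W K : ℕ) (G : SimpleGraph (Fin n)) (L : Fin n → Finset (Fin q))
    (Q : Finset (Fin n)) (z : Search) : Prop where
  inst : z.1 = toInst G L Q
  isPartial : ∀ f ∈ z.2.1, IsPartial (q + 1) (toInst G L Q) f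
  stack : StackBound W (hubs (toInst G L Q)).length (toInst G L Q) z.2.1
  sol : ∃ X, IsDeletionSet G L X ∧ z.2.2 = bits X
  opt : (∀ Y, IsDeletionSet G L Y → ones z.2.2 ≤ Y.card) ∨ ∃ f ∈ z.2.1, ∃ g : ℕ → ℕ,
    (∀ u, g u < q + 1) ∧ (∀ u, assigned f u = true → g u = col f u) ∧
      ∀ Y, IsDeletionSet G L Y → objective (q + 1) σ (toInst G L Q) g ≤ Y.card

theorem free_nil (I : Inst) : free I [] = hubs I := by
  simp [free, assigned]

/-- The first solution deletes every vertex, and the empty assignment is extended by the coloring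
that belongs to a minimum deletion set. -/
theorem searchInv_init {W K : ℕ} (hQ : IsHub G σ δ Q) :
    SearchInv σ W K G L Q (searchInit (toInst G L Q)) := by
  classical
  have huniv : IsDeletionSet G L Finset.univ := by
    have hE : ∀ v : {v : Fin n | v ∉ (Finset.univ : Finset (Fin n))}, False := fun v =>
      v.2 (Finset.mem_univ _)
    exact ⟨SimpleGraph.Coloring.mk (fun v => (hE v).elim) fun {v} => (hE v).elim,
      fun v => (hE v).elim⟩
  refine ⟨rfl, ?_, ⟨?_, trivial⟩, ⟨Finset.univ, huniv, ?_⟩, .inr ?_⟩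
  · intro f hf
    obtain rfl : f = [] := by simpa [searchInit] using hf
    simp [IsPartial]
  · rw [free_nil]
    simp
  · change (verts (toInst G L Q)).map (fun _ => true) = _
    rw [map_verts]
    simp
  · obtain ⟨Y, hY, hmin⟩ := Finset.exists_min_image
      (Finset.univ.filter fun Y : Finset (Fin n) => IsDeletionSet G L Y) Finset.card
      ⟨Finset.univ, by simpa using huniv⟩
    obtain ⟨g, hg, hle⟩ := exists_objective_le hQ (Finset.mem_filter.1 hY).2
    exact ⟨[], by simp [searchInit], g, hg, by simp [assigned], fun Y' hY' =>
      hle.trans (hmin Y' (by simpa using hY'))⟩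

/-- Branching preserves an extension that is good enough, by `Prunes.exists_child`. If nothing can
be pruned, the whole hub is assigned, so an extension tracked by the invariant agrees with the
assignment on the hub, and `ones_solution_le` makes the computed solution optimal. -/
theorem searchInv_step {W K : ℕ} (hq : 2 ≤ q) (hQ : IsHub G σ δ Q)
    (hK : 2 * max δ 2 ≤ K) (hK' : 1 + (q + 1) ^ max δ 2 * max δ 2 ≤ K) (hW : (q + 1) ^ K ≤ W)
    {r : ℝ} (hr : 1 ≤ r) (hrK : ∀ k, 1 ≤ k → k ≤ K → ((q + 1 : ℕ) : ℝ) ^ k - 1 ≤ r ^ k)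
    {z : Search} (hz : SearchInv σ W K G L Q z) (hact : active z = true) :
    SearchInv σ W K G L Q (searchStep (q + 1) σ (max δ 2) K z) ∧
      potential r (toInst G L Q) (searchStep (q + 1) σ (max δ 2) K z).2.1 + 1 ≤
        potential r (toInst G L Q) z.2.1 := by
  obtain ⟨I, l, b⟩ := z
  obtain ⟨hI, hpart, hstack, hsol, hopt⟩ := hz
  simp only at hI hpart hstack hsol hopt
  subst hI
  have hB := bounded_toInst (L := L) hQ
  have hP := isPartition_toInst (L := L) hQ
  cases l with
  | nil => simp [active] at hact
  | cons f l =>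
    have hf := hpart f List.mem_cons_self
    have hpot : potential r (toInst G L Q) (f :: l) =
        2 * r ^ (free (toInst G L Q) f).length - 1 + potential r (toInst G L Q) l := by
      simp [potential]
    cases hpr : prunable (q + 1) σ (max δ 2) K (toInst G L Q) f with
    | nil =>
      have hstep : searchStep (q + 1) σ (max δ 2) K (toInst G L Q, f :: l, b) =
          (toInst G L Q, l, if decide (ones (solution (q + 1) σ (toInst G L Q) f) ≤ ones b) = true
            then solution (q + 1) σ (toInst G L Q) f else b) := by
        simp [searchStep, hpr]
      rw [hstep]
      have hfree : free (toInst G L Q) f = [] := by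
        by_contra hne
        exact prunable_ne_nil_of_free (by omega) hB hK hK' (fun p hp => (hf.1 p hp).2) hne hpr
      refine ⟨⟨rfl, fun f' hf' => hpart f' (List.mem_cons_of_mem _ hf'), hstack.2, ?_, ?_⟩, ?_⟩
      · simp only
        split
        · exact ⟨_, isDeletionSet_toDelete (Q := Q) _, map_verts _⟩
        · exact hsol
      · have hle : ∀ m, ones b ≤ m ∨ ones (solution (q + 1) σ (toInst G L Q) f) ≤ m →
            ones (if decide (ones (solution (q + 1) σ (toInst G L Q) f) ≤ ones b) = true
              then solution (q + 1) σ (toInst G L Q) f else b) ≤ m := by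
          intro m hm
          split
          · rename_i h
            rw [decide_eq_true_eq] at h
            omega
          · rename_i h
            rw [decide_eq_true_eq] at h
            omega
        rcases hopt with hopt | ⟨f', hf', g, hg, hfg, hgY⟩
        · exact .inl fun Y hY => hle _ (.inl (hopt Y hY))
        · rcases List.mem_cons.1 hf' with rfl | hf'
          · refine .inl fun Y hY => hle _ (.inr ?_)
            refine (ones_solution_le (by omega) hB hP f').trans (le_trans (le_of_eq ?_) (hgY Y hY))
            refine objective_congr (by omega) fun u hu => (hfg u ?_).symm
            cases hfu : assigned f' u with
            | true => rfl
            | false => exact absurd (mem_free.2 ⟨hu, hfu⟩) (by simp [hfree])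
          · exact .inr ⟨f', hf', g, hg, hfg, hgY⟩
      -- A full assignment has potential `2 * 1 - 1 = 1`, which pays for its removal.
      · rw [hpot, hfree]
        simp only [List.length_nil, pow_zero]
        linarith
    | cons y ys =>
      obtain ⟨τ, v, x⟩ := y
      have hpru : Prunes (q + 1) σ (max δ 2) K (toInst G L Q) f τ v x :=
        prunes_of_mem (by rw [hpr]; exact List.mem_cons_self)
      have hstep : searchStep (q + 1) σ (max δ 2) K (toInst G L Q, f :: l, b) =
          (toInst G L Q, children (q + 1) K f τ ++ l, b) := by
        simp [searchStep, hpr]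
      rw [hstep]
      refine ⟨⟨rfl, fun f' hf' => ?_, ?_, hsol, ?_⟩, ?_⟩
      · rcases List.mem_append.1 hf' with hf' | hf'
        · exact hpru.isPartial hf hf'
        · exact hpart f' (List.mem_cons_of_mem _ hf')
      · refine hstack.2.append hstack.1 ?_ fun f' hf' => ?_
        · have h1 := hpru.length_children
          have h2 := Nat.pow_le_pow_right (show 0 < q + 1 by omega) hpru.length_le
          omega
        · have := hpru.length_free hf'
          have := hpru.pos
          omega
      · rcases hopt with hopt | ⟨f', hf', g, hg, hfg, hgY⟩
        · exact .inl hopt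
        · rcases List.mem_cons.1 hf' with rfl | hf'
          · obtain ⟨f'', hf'', g', hg', hfg', hle⟩ := hpru.exists_child (by omega) hB hg hfg
            exact .inr ⟨f'', List.mem_append_left _ hf'', g', hg', hfg', fun Y hY =>
              hle.trans (hgY Y hY)⟩
          · exact .inr ⟨f', List.mem_append_right _ hf', g, hg, hfg, hgY⟩
      · rw [hpot]
        have h1 := hpru.potential_children hr (by omega) hrK
        have h2 : potential r (toInst G L Q) (children (q + 1) K f τ ++ l) =
            potential r (toInst G L Q) (children (q + 1) K f τ) + potential r (toInst G L Q) l := by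
          simp [potential]
        simp only [h2]
        linarith

/-! ### Sizes -/

/-- A bound for the sizes of the states of the search. -/
noncomputable def sizePoly (q W : ℕ) : ℕ[X] :=
  (X * (2 * X + 1) + (X * (2 * C q + 1) + X * 2 + 1) + 1) +
    ((C W * X + 1) * (X * (X + C q + 3) + 1) + X * 2 + 1) + 1

theorem sz_bools_le {m : ℕ} (b : Fin m → Bool) : sz (List.ofFn b) ≤ m * 2 := by
  simpa using sz_le_mul (l := List.ofFn b) (k := 1) fun a _ => sz_bool a

theorem sz_matrix_le {m k : ℕ} (b : Fin m → Fin k → Bool) :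
    sz (List.ofFn fun i => List.ofFn (b i)) ≤ m * (2 * k + 1) := by
  have h := sz_le_mul (l := List.ofFn fun i => List.ofFn (b i)) (k := k * 2) fun a ha => by
    obtain ⟨i, rfl⟩ := (List.mem_ofFn' _ _).1 ha
    exact sz_bools_le _
  rwa [List.length_ofFn, mul_comm k 2] at h

theorem sz_toInst_le : sz (toInst G L Q) ≤ n * (2 * n + 1) + (n * (2 * q + 1) + n * 2 + 1) + 1 := by
  classical
  have h1 := sz_matrix_le fun u v : Fin n => decide (G.Adj u v)
  have h2 := sz_matrix_le fun (v : Fin n) (i : Fin q) => decide (i ∈ L v)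
  have h3 := sz_bools_le fun v : Fin n => decide (v ∈ Q)
  rw [toInst, sz_pair, sz_pair]
  convert Nat.add_le_add_right (Nat.add_le_add h1
    (Nat.add_le_add_right (Nat.add_le_add h2 h3) 1)) 1

theorem IsPartial.sz_le {f : PA} (hf : IsPartial (q + 1) (toInst G L Q) f) :
    sz f ≤ n * (n + q + 3) := by
  have hlen : f.length ≤ n := by
    have h1 : (f.map Prod.fst).length ≤ (List.range n).length :=
      (List.subperm_of_subset hf.2 fun u hu => by
        obtain ⟨p, hp, rfl⟩ := List.mem_map.1 hu
        obtain ⟨h, -⟩ := mem_hubs_toInst.1 (hf.1 p hp).1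
        exact List.mem_range.2 h).length_le
    simpa using h1
  refine (sz_le_mul (k := n + q + 2) fun p hp => ?_).trans (Nat.mul_le_mul_right _ hlen)
  obtain ⟨u, a⟩ := p
  obtain ⟨h1, h2⟩ := hf.1 _ hp
  obtain ⟨h3, -⟩ := mem_hubs_toInst.1 h1
  rw [sz_pair, sz_nat, sz_nat]
  simp only at h2 h3
  omega

theorem length_hubs_le : (hubs (toInst G L Q)).length ≤ Q.card := by
  have h : (hubs (toInst G L Q)).toFinset ⊆ Q.map Fin.valEmbedding := by
    intro v hv
    obtain ⟨h1, h2⟩ := mem_hubs_toInst.1 (List.mem_toFinset.1 hv)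
    exact Finset.mem_map.2 ⟨_, h2, rfl⟩
  have h' := Finset.card_le_card h
  rwa [List.toFinset_card_of_nodup nodup_hubs, Finset.card_map] at h'

/-- The stack stays of polynomial length by `StackBound`, so a single round is polynomial no matter
how many rounds there are. -/
theorem SearchInv.sz_le {W K : ℕ} {z : Search} (hz : SearchInv σ W K G L Q z) :
    sz z ≤ (sizePoly q W).eval n := by
  obtain ⟨I, l, b⟩ := z
  obtain ⟨hI, hpart, hstack, ⟨X, -, hX⟩, -⟩ := hz
  simp only at hI hpart hstack hX
  subst hI hX
  have h1 := sz_toInst_le (G := G) (L := L) (Q := Q)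
  have h2 : sz (bits X) ≤ n * 2 := sz_bools_le _
  have h3 := sz_le_mul (l := l) (k := n * (n + q + 3)) fun f hf => (hpart f hf).sz_le
  have h4 : l.length ≤ W * n + 1 := by
    refine hstack.length_le.trans (Nat.add_le_add_right (Nat.mul_le_mul_left _ ?_) _)
    exact length_hubs_le.trans (by simpa using Finset.card_le_univ Q)
  have h5 := Nat.mul_le_mul_right (n * (n + q + 3) + 1) h4
  have h6 : sz (toInst G L Q, l, bits X) = sz (toInst G L Q) + (sz l + sz (bits X) + 1) + 1 := rfl
  rw [h6]
  simp only [sizePoly, eval_add, eval_mul, eval_X, eval_one, eval_C, eval_ofNat]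
  omega

end

/-! ### The bound for the total running time -/

theorem exists_eval_le (p : ℕ[X]) : ∃ c : ℕ, ∀ n : ℕ, p.eval n ≤ c * (n + 1) ^ c := by
  refine ⟨(∑ i ∈ Finset.range (p.natDegree + 1), p.coeff i) + p.natDegree, fun n => ?_⟩
  rw [eval_eq_sum_range]
  calc ∑ i ∈ Finset.range (p.natDegree + 1), p.coeff i * n ^ i
      ≤ ∑ i ∈ Finset.range (p.natDegree + 1), p.coeff i * (n + 1) ^ p.natDegree := by
        refine Finset.sum_le_sum fun i hi => Nat.mul_le_mul_left _ ?_
        exact (Nat.pow_le_pow_left (Nat.le_succ n) i).trans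
          (Nat.pow_le_pow_right (Nat.succ_pos n) (Nat.lt_succ_iff.1 (Finset.mem_range.1 hi)))
    _ = (∑ i ∈ Finset.range (p.natDegree + 1), p.coeff i) * (n + 1) ^ p.natDegree := by
        rw [Finset.sum_mul]
    _ ≤ _ := Nat.mul_le_mul (Nat.le_add_right _ _)
        (Nat.pow_le_pow_right (Nat.succ_pos n) (Nat.le_add_left _ _))

/-- The base of the running time. -/
theorem exists_base (d K : ℕ) (hd : 2 ≤ d) : ∃ ε : ℝ, 0 < ε ∧ 1 ≤ (d : ℝ) - ε ∧
    ∀ k, 1 ≤ k → k ≤ K → (d : ℝ) ^ k - 1 ≤ ((d : ℝ) - ε) ^ k := by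
  have hd' : (2 : ℝ) ≤ d := by exact_mod_cast hd
  have hpow : (1 : ℝ) ≤ (d : ℝ) ^ K := one_le_pow₀ (by linarith)
  have hpos : (1 : ℝ) ≤ (K + 1) * (d : ℝ) ^ K := by nlinarith [(Nat.cast_nonneg K : (0 : ℝ) ≤ K)]
  have hε : 1 / ((K + 1) * (d : ℝ) ^ K) ≤ 1 := by
    rw [div_le_one (by linarith)]
    exact hpos
  -- This `ε` satisfies `k * d ^ (k - 1) * ε ≤ 1` for `1 ≤ k ≤ K`, and Bernoulli's inequality gives
  -- `(d - ε) ^ k ≥ d ^ k - k * d ^ (k - 1) * ε`.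
  refine ⟨1 / ((K + 1) * (d : ℝ) ^ K), by positivity, by linarith, fun k hk1 hk => ?_⟩
  set ε := 1 / ((K + 1) * (d : ℝ) ^ K) with hεdef
  have hε0 : 0 < ε := by positivity
  have hd0 : (d : ℝ) ≠ 0 := by linarith
  have h1 : (d : ℝ) - ε = d * (1 + -(ε / d)) := by
    field_simp
    ring
  have hεd : ε / d ≤ 1 := by
    rw [div_le_one (by linarith)]
    linarith
  have h2 := one_add_mul_le_pow (show (-2 : ℝ) ≤ -(ε / d) by linarith) k
  obtain ⟨j, rfl⟩ : ∃ j, k = j + 1 := ⟨k - 1, by omega⟩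
  have h3 : ((j + 1 : ℕ) : ℝ) * (d : ℝ) ^ j * ε ≤ 1 := by
    rw [hεdef, mul_one_div, div_le_one (by linarith)]
    have h4 : (d : ℝ) ^ j ≤ (d : ℝ) ^ K := pow_le_pow_right₀ (by linarith) (by omega)
    have h5 : ((j + 1 : ℕ) : ℝ) ≤ K + 1 := by
      have : ((j + 1 : ℕ) : ℝ) ≤ (K : ℕ) := by exact_mod_cast hk
      linarith
    exact mul_le_mul h5 h4 (by positivity) (by positivity)
  rw [h1, mul_pow]
  refine le_trans ?_ (mul_le_mul_of_nonneg_left h2 (by positivity))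
  have h6 : (d : ℝ) ^ (j + 1) * (1 + ((j + 1 : ℕ) : ℝ) * -(ε / d)) =
      (d : ℝ) ^ (j + 1) - ((j + 1 : ℕ) : ℝ) * (d : ℝ) ^ j * ε := by
    rw [pow_succ]
    field_simp
    ring
  rw [h6]
  linarith

theorem exists_solvableInTime (hq : 2 ≤ q) (σ δ : ℕ) : ∃ ε : ℝ, 0 < ε ∧ ∃ c : ℕ,
    SolvableInTime q σ δ
      (fun p n => ((q : ℝ) + 1 - ε) ^ p * ((c : ℝ) * ((n : ℝ) + 1) ^ c)) := by
  obtain ⟨ε, hε, hr, hrK⟩ := exists_base (q + 1)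
    (2 * max δ 2 + (1 + (q + 1) ^ max δ 2 * max δ 2)) (by omega)
  -- The sum of two demands on `K`, with `D = max δ 2`: `2 * D` vertices for two compatible
  -- constraints, and `1 + d ^ D * D` for all relevant constraints when they are few.
  set K := 2 * max δ 2 + (1 + (q + 1) ^ max δ 2 * max δ 2) with hK
  set r : ℝ := ((q + 1 : ℕ) : ℝ) - ε with hrdef
  obtain ⟨P₁, p₁, hP₁⟩ := PolyTime.searchInit
  obtain ⟨P₂, p₂, hP₂⟩ := exists_loop PolyTime.active (PolyTime.searchStep (q + 1) σ (max δ 2) K)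
  obtain ⟨P₃, p₃, hP₃⟩ := PolyTime.snd (PolyTime.snd (PolyTime.id (α := Search)))
  obtain ⟨i₁, i₂, i₃, hlink⟩ := exists_link P₁ P₂ P₃
  obtain ⟨R, h0, h1, h2, h3⟩ := hlink (.call i₃ (.call i₂ (.call i₁ (.var 0))))
  set W := (q + 1) ^ K with hW
  -- The 6 counts two variable accesses and four calls of the linked program; the factor 2 comes
  -- from the initial potential plus one, which is at most `2 * r ^ p`.
  obtain ⟨c, hc⟩ := exists_eval_le ((6 + p₁ + 2 * p₂ + p₃).comp (sizePoly q W))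
  refine ⟨ε, hε, c, R, fun n G L Q hQ => ?_⟩
  set M := (sizePoly q W).eval n with hM
  have hinit : SearchInv σ W K G L Q (searchInit (toInst G L Q)) := searchInv_init hQ
  obtain ⟨z, hz, hact, t₂, ht₂, hrun₂⟩ := hP₂ (SearchInv σ W K G L Q)
    (fun z => potential r (toInst G L Q) z.2.1) M
    (fun z hz => ⟨hz.sz_le, potential_nonneg hr _, fun hact =>
      searchInv_step (by omega) hQ (Nat.le_add_right _ _) (Nat.le_add_left _ _) le_rfl
        hr hrK hz hact⟩) _ hinit
  obtain ⟨-, t₁, ht₁, hrun₁⟩ := hP₁ (toInst G L Q)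
  obtain ⟨-, t₃, ht₃, hrun₃⟩ := hP₃ z
  obtain ⟨X, hX, hXb⟩ := hz.sol
  have hopt : ∀ Y, IsDeletionSet G L Y → X.card ≤ Y.card := by
    intro Y hY
    rcases hz.opt with h | ⟨f, hf, -⟩
    · rw [← ones_bits X, ← hXb]
      exact h Y hY
    · have : z.2.1 = [] := by simpa [active] using hact
      simp [this] at hf
  have hrun := hrun₃.call h3 (hrun₂.call h2
    (hrun₁.call h1 (.var (env := [Enc.enc (toInst G L Q)]) (i := 0) rfl)))
  simp only [enc_toInst, hXb, enc_bits] at hrun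
  refine ⟨X, _, ⟨hX, hopt⟩, .call (.var rfl) h0 hrun, ?_⟩
  have hsz : sz (toInst G L Q) ≤ M := by
    refine le_trans ?_ hinit.sz_le
    simp only [searchInit, sz_pair]
    omega
  have e₁ := ht₁.trans (eval_mono p₁ hsz)
  have e₃ := ht₃.trans (eval_mono p₃ hz.sz_le)
  have e₁' : (t₁ : ℝ) ≤ (p₁.eval M : ℕ) := by exact_mod_cast e₁
  have e₃' : (t₃ : ℝ) ≤ (p₃.eval M : ℕ) := by exact_mod_cast e₃
  have hpot : potential r (toInst G L Q) (searchInit (toInst G L Q)).2.1 + 1 ≤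
      2 * r ^ Q.card := by
    have := pow_le_pow_right₀ hr (length_hubs_le (G := G) (L := L) (Q := Q))
    simp only [searchInit, potential, List.map_cons, List.map_nil, List.sum_cons, List.sum_nil,
      free_nil]
    linarith
  have e₂ := ht₂.trans (mul_le_mul_of_nonneg_right hpot
    (Nat.cast_nonneg (α := ℝ) (p₂.eval M)))
  have hone : 1 ≤ r ^ Q.card := one_le_pow₀ hr
  have hc' : ((((6 + p₁ + 2 * p₂ + p₃).comp (sizePoly q W)).eval n : ℕ) : ℝ) ≤
      (c : ℝ) * ((n : ℝ) + 1) ^ c := by exact_mod_cast hc n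
  rw [eval_comp, ← hM] at hc'
  simp only [eval_add, eval_mul, eval_ofNat] at hc'
  push_cast at hc'
  have hr' : (q : ℝ) + 1 - ε = r := by
    rw [hrdef]
    push_cast
    ring
  simp only [hr']
  refine le_trans ?_ (mul_le_mul_of_nonneg_left hc' (by linarith))
  have n₁ : (0 : ℝ) ≤ (p₁.eval M : ℕ) := Nat.cast_nonneg _
  have n₃ : (0 : ℝ) ≤ (p₃.eval M : ℕ) := Nat.cast_nonneg _
  push_cast
  nlinarith [mul_le_mul_of_nonneg_right hone n₁, mul_le_mul_of_nonneg_right hone n₃]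

end HubColoring

/-- Vertex deletion to (list) `q`-coloring with a given `(σ, δ)`-hub of size `p` in an `n`-vertex
graph is solved in time `(q + 1 - ε) ^ p * n ^ O(1)`.  The problem without lists is the case in
which every list consists of all `q` colors. -/
theorem theorem1p7 (q σ δ : ℕ) (hq : 3 ≤ q) (hσ : 0 < σ) (hδ : 0 < δ) :
    ∃ ε : ℝ, 0 < ε ∧ ∃ c : ℕ,
      HubColoring.SolvableInTime q σ δ
        (fun p n => ((q : ℝ) + 1 - ε) ^ p * ((c : ℝ) * ((n : ℝ) + 1) ^ c)) := by
  exact HubColoring.exists_solvableInTime (by omega) σ δ
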